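/- Let $G$ be a finite undirected graph, loops and multiple edges allowed, with vertex set $V$ of size $n$, edge set $E$, and $\kappa$ connected components, and let $g=|E|-n+\kappa$. Fix a total order $<$ on $E$, a reference orientation (for each edge $e$ a positive direction $e^+$ and the opposite direction $e^-$) and sign labels $\sigma_u,\sigma_b\colon E\to\{+,-\}$. *Subgraphs.* For $S\subseteq E$ let $\kappa(S)$ be the number of connected components of $(V,S)$, and let $$T_G(x,y)=\sum_{S\subseteq E}(x-1)^{\kappa(S)-\kappa}(y-1)^{|S|+\kappa(S)-n}.$$ A *cut* is a minimal nonempty $C\subseteq E$ with $\kappa(E\setminus C)>\kappa$; a *cycle* is a minimal nonempty $C\subseteq E$ that meets no cut in exactly one element (equivalently, the edge set of a graph cycle). Let $\hat I(S)$ be the set of edges $e$ that are the minimum of some cut disjoint from $S\setminus\{e\}$, and $\hat L(S)$ the set of edges $e$ that are the minimum of some cycle contained in $S\cup\{e\}$. *Fourientations.* A *fourientation* is a subset $O$ of $\mathbb E=\{e^+,e^-: e\in E\}$. Write $O^u$, $O^b$, $O^+$, $O^-$ for the sets of edges $e$ with $O\cap\{e^+,e^-\}$ equal to $\varnothing$,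 $\{e^+,e^-\}$, $\{e^+\}$, $\{e^-\}$ respectively, and $O^o=O^+\cup O^-$; $O$ is an *orientation* if $O^o=E$. A *directed cut* (*directed cycle*) is a cut (cycle) with one of its two consistent orientations, viewed as a subset of $\mathbb E$. A directed cut $D$ is a *potential cut* of $O$ if $e^{\delta}\in D$ implies $e^{-\delta}\notin O$; a directed cycle $D$ is a *potential cycle* of $O$ if $D\subseteq O$. Put - $I^o(O)=\{e\in O^o: e$ is the minimum edge of some potential cut of $O\}$, - $L^o(O)=\{e\in O^o: e$ is the minimum edge of some potential cycle of $O\}$, - $I^u(O)=\{e\in O^u: e$ is the minimum edge of some potential cut of $O\cup\{e^{\sigma_u(e)}\}\}$, - $L^b(O)=\{e\in O^b: e$ is the minimum edge of some potential cycle of $O\setminus\{e^{\sigma_b(e)}\}\}$. **Theorem.** There are maps $I$ (cut activity), $L$ (cycle activity) and $\varphi$ from the set of fourientations of $G$ to the set of subsets of $E$ such that: 1. $\varphi$ is a $2^{|E|}$-to-one surjection, and $O\mapsto(\varphi(O),O^o)$ is a bijection from fourientations to pairs of subsets of $E$; 2. $O^u\cap\varphi(O)=\varnothing$ and $O^b\subseteq\varphi(O)$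 for every $O$; 3. $I(O)=\hat I(\varphi(O))$ and $L(O)=\hat L(\varphi(O))$ for every $O$; 4. $I(O)\cap O^o=I^o(O)$, $I(O)\cap O^u=I^u(O)$, $L(O)\cap O^o=L^o(O)$ and $L(O)\cap O^b=L^b(O)$ for every $O$; 5. writing $I^{\bullet}(O)=I(O)\cap O^{\bullet}$ and $L^{\bullet}(O)=L(O)\cap O^{\bullet}$ for $\bullet\in\{+,-,u,b\}$, we have $I^+(O)\subseteq\varphi(O)$, $I^-(O)\cap\varphi(O)=\varnothing$, $L^-(O)\subseteq\varphi(O)$ and $L^+(O)\cap\varphi(O)=\varnothing$ for every $O$; 6. if $O^o=\varnothing$, then $I(O)=\hat I(O^b)$ and $L(O)=\hat L(O^b)$; 7. for all elements $k_1,k_2,l,m,x,w,\hat x,\hat w,y,z,\hat y,\hat z$ of a field (for instance, independent indeterminates in a field of rational functions) with $k_1+m\neq0$ and $k_2+l\neq 0$, $$(k_1+m)^{n-\kappa}(k_2+l)^{g}\,T_G\!\left(\frac{k_1x+k_2w+m\hat x+l\hat w}{k_1+m},\frac{k_2y+k_1z+l\hat y+m\hat z}{k_2+l}\right)$$ $$=\sum_{O\subseteq\mathbb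 E}k_1^{|O^o\cap\varphi(O)|}k_2^{|O^o\setminus\varphi(O)|}l^{|O^u|}m^{|O^b|}x^{|I^+(O)|}w^{|I^-(O)|}\hat x^{|I^b(O)|}\hat w^{|I^u(O)|}y^{|L^+(O)|}z^{|L^-(O)|}\hat y^{|L^u(O)|}\hat z^{|L^b(O)|};$$ 8. at $(k_1,k_2,l,m)=(0,0,1,1)$ the right-hand side of 7 is the Gordon–Traldi sum, so that $T_G(\hat x+\hat w,\hat y+\hat z)=\sum_{S\subseteq E}\hat x^{|\hat I(S)\cap S|}\hat w^{|\hat I(S)\setminus S|}\hat y^{|\hat L(S)\setminus S|}\hat z^{|\hat L(S)\cap S|}$; 9. at $(k_1,k_2,l,m)=(1,1,0,0)$ the right-hand side of 7 is the Las Vergnas sum, so that $T_G(x+w,y+z)=\sum_{O}x^{|A(O)\cap O^+|}w^{|A(O)\cap O^-|}y^{|B(O)\cap O^+|}z^{|B(O)\cap O^-|}$, the sum being over all orientations $O$ of $G$, where $A(O)$ (resp. $B(O)$) is the set of minimum edges of the directed cuts (resp. directed cycles) contained in $O$. -/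

import Mathlib

namespace Graph

noncomputable section

variable {α β : Type*}

/-- A reference orientation: for each edge `e` a positive direction, from `tail e` to `head e`.
A loop has `tail e = head e`. -/
structure RefOrientation (G : Graph α β) where
  tail : G.edgeSet → G.vertexSet
  head : G.edgeSet → G.vertexSet
  isLink : ∀ e : G.edgeSet, G.IsLink e (tail e) (head e)

/-- The directed edges of `G`: `(e, true)` is `e⁺` and `(e, false)` is `e⁻`. These are two different
symbols also when `e` is a loop. -/
abbrev DirEdge (G : Graph α β) := G.edgeSet × Bool

/-- A fourientation is an arbitrary set of directed edges. -/
abbrev Fourientation (G : Graph α β) := Finset G.DirEdge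

/-- The vertex that a directed edge leaves. -/
def RefOrientation.src {G : Graph α β} (R : G.RefOrientation) (d : G.DirEdge) : G.vertexSet :=
  if d.2 then R.tail d.1 else R.head d.1

/-- The vertex that a directed edge enters. -/
def RefOrientation.tgt {G : Graph α β} (R : G.RefOrientation) (d : G.DirEdge) : G.vertexSet :=
  if d.2 then R.head d.1 else R.tail d.1

/-- The number of connected components of the spanning subgraph with edge set `S`: the number of
classes of the equivalence relation on the vertices that the edges of `S` generate. -/
def numComponents (G : Graph α β) (S : Finset G.edgeSet) : ℕ :=
  Nat.card (Quot fun x y : G.vertexSet => ∃ e ∈ S, G.IsLink e x y)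

section Basic

variable (G : Graph α β) [Fintype G.vertexSet] [Fintype G.edgeSet]

/-- The Tutte polynomial, evaluated at `(x, y)`. Neither subtraction of natural numbers
truncates. -/
def tutte {K : Type*} [CommRing K] (x y : K) : K :=
  ∑ S : Finset G.edgeSet,
    (x - 1) ^ (G.numComponents S - G.numComponents Finset.univ) *
      (y - 1) ^ (S.card + G.numComponents S - Fintype.card G.vertexSet)

/-- The rank `n - κ`. -/
def rk : ℕ := Fintype.card G.vertexSet - G.numComponents Finset.univ

/-- The cyclomatic number `|E| - n + κ`. -/
def cyclomatic : ℕ :=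
  Fintype.card G.edgeSet + G.numComponents Finset.univ - Fintype.card G.vertexSet

end Basic

section Activities

variable (G : Graph α β) [Fintype G.edgeSet] [LinearOrder G.edgeSet]

/-- A cut is a minimal nonempty set of edges whose removal increases the number of connected
components. -/
def IsCut (C : Finset G.edgeSet) : Prop :=
  Minimal (fun S : Finset G.edgeSet =>
    S.Nonempty ∧ G.numComponents Finset.univ < G.numComponents Sᶜ) C

/-- A cycle is a minimal nonempty set of edges that meets no cut in precisely one element. -/
def IsCycle (C : Finset G.edgeSet) : Prop :=
  Minimal (fun S : Finset G.edgeSet =>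
    S.Nonempty ∧ ∀ K, G.IsCut K → (K ∩ S).card ≠ 1) C

open Classical in
/-- Generalized cut activity of a spanning subgraph `S`: the edges `e` that are the minimum of some
cut disjoint from `S \ {e}`. -/
def genCutAct (S : Finset G.edgeSet) : Finset G.edgeSet :=
  Finset.univ.filter fun e =>
    ∃ C, G.IsCut C ∧ Disjoint C (S \ {e}) ∧ IsLeast (C : Set G.edgeSet) e

open Classical in
/-- Generalized cycle activity of a spanning subgraph `S`: the edges `e` that are the minimum of
some cycle contained in `S ∪ {e}`. -/
def genCycleAct (S : Finset G.edgeSet) : Finset G.edgeSet :=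
  Finset.univ.filter fun e =>
    ∃ C, G.IsCycle C ∧ C ⊆ S ∪ {e} ∧ IsLeast (C : Set G.edgeSet) e

variable {G}

/-- The underlying edges of a set of directed edges. -/
def edges (D : Finset G.DirEdge) : Finset G.edgeSet := D.image Prod.fst

/-- `e` is the minimum edge of the directed cut or directed cycle `D`. -/
def IsMinEdge (e : G.edgeSet) (D : Finset G.DirEdge) : Prop :=
  IsLeast (edges D : Set G.edgeSet) e

/-- A directed cut: a cut that consists of the edges between a vertex set `X` and its complement,
all directed out of `X`. -/
def IsDirectedCut (R : G.RefOrientation) (D : Finset G.DirEdge) : Prop :=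
  G.IsCut (edges D) ∧
    ∃ X : Set G.vertexSet, ∀ d : G.DirEdge, d ∈ D ↔ R.src d ∈ X ∧ R.tgt d ∉ X

open Classical in
/-- A directed cycle: a cycle, each of whose edges is given one direction, such that every vertex is
entered as often as it is left. A cycle has exactly two such orientations, the two ways to traverse
it. -/
def IsDirectedCycle (R : G.RefOrientation) (D : Finset G.DirEdge) : Prop :=
  G.IsCycle (edges D) ∧
    (∀ e : G.edgeSet, ¬ ((e, true) ∈ D ∧ (e, false) ∈ D)) ∧
    ∀ v : G.vertexSet, (D.filter fun d => R.src d = v).card = (D.filter fun d => R.tgt d = v).card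

/-- A directed cut `D` is a potential cut of `O` if no edge of `D` has its opposite direction
in `O`. -/
def IsPotentialCut (R : G.RefOrientation) (O : G.Fourientation) (D : Finset G.DirEdge) : Prop :=
  IsDirectedCut R D ∧ ∀ d ∈ D, (d.1, !d.2) ∉ O

/-- A directed cycle `D` is a potential cycle of `O` if all its directed edges are in `O`. -/
def IsPotentialCycle (R : G.RefOrientation) (O : G.Fourientation) (D : Finset G.DirEdge) : Prop :=
  IsDirectedCycle R D ∧ ∀ d ∈ D, d ∈ O

namespace Fourientation

/-- The unoriented edges `O^u`. -/
def unor (O : G.Fourientation) : Finset G.edgeSet :=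
  Finset.univ.filter fun e => (e, true) ∉ O ∧ (e, false) ∉ O

/-- The bioriented edges `O^b`. -/
def bior (O : G.Fourientation) : Finset G.edgeSet :=
  Finset.univ.filter fun e => (e, true) ∈ O ∧ (e, false) ∈ O

/-- The simply oriented edges that agree with the reference orientation, `O^+`. -/
def pos (O : G.Fourientation) : Finset G.edgeSet :=
  Finset.univ.filter fun e => (e, true) ∈ O ∧ (e, false) ∉ O

/-- The simply oriented edges that disagree with the reference orientation, `O^-`. -/
def neg (O : G.Fourientation) : Finset G.edgeSet :=
  Finset.univ.filter fun e => (e, true) ∉ O ∧ (e, false) ∈ O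

/-- The simply oriented edges `O^o`. -/
def ori (O : G.Fourientation) : Finset G.edgeSet := O.pos ∪ O.neg

/-- `O` is an orientation: every edge has exactly one of its two directions in `O`. -/
def IsOrientation (O : G.Fourientation) : Prop :=
  ∀ e : G.edgeSet, Xor ((e, true) ∈ O) ((e, false) ∈ O)

open Classical in
/-- The oriented cut active edges `I^o(O)`. -/
def cutActOri (R : G.RefOrientation) (O : G.Fourientation) : Finset G.edgeSet :=
  O.ori.filter fun e => ∃ D, IsPotentialCut R O D ∧ IsMinEdge e D

open Classical in
/-- The oriented cycle active edges `L^o(O)`. -/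
def cycleActOri (R : G.RefOrientation) (O : G.Fourientation) : Finset G.edgeSet :=
  O.ori.filter fun e => ∃ D, IsPotentialCycle R O D ∧ IsMinEdge e D

open Classical in
/-- The unoriented cut active edges `I^u(O)`, for the sign labels `σu`. -/
def cutActUnor (R : G.RefOrientation) (σu : G.edgeSet → Bool) (O : G.Fourientation) :
    Finset G.edgeSet :=
  O.unor.filter fun e => ∃ D, IsPotentialCut R (O ∪ {(e, σu e)}) D ∧ IsMinEdge e D

open Classical in
/-- The bioriented cycle active edges `L^b(O)`, for the sign labels `σb`. -/
def cycleActBior (R : G.RefOrientation) (σb : G.edgeSet → Bool) (O : G.Fourientation) :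
    Finset G.edgeSet :=
  O.bior.filter fun e => ∃ D, IsPotentialCycle R (O \ {(e, σb e)}) D ∧ IsMinEdge e D

open Classical in
/-- The cut active edges of an orientation: minimum edges of directed cuts contained in it. -/
def orientationCutAct (R : G.RefOrientation) (O : G.Fourientation) : Finset G.edgeSet :=
  Finset.univ.filter fun e => ∃ D, IsDirectedCut R D ∧ D ⊆ O ∧ IsMinEdge e D

open Classical in
/-- The cycle active edges of an orientation: minimum edges of directed cycles contained in it. -/
def orientationCycleAct (R : G.RefOrientation) (O : G.Fourientation) : Finset G.edgeSet :=
  Finset.univ.filter fun e => ∃ D, IsDirectedCycle R D ∧ D ⊆ O ∧ IsMinEdge e D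

end Fourientation

/-- The sum over all fourientations in the twelve variable expansion; `x'`, `w'`, `y'`, `z'` are the
variables with hats. -/
def fourientationSum (I L φ : G.Fourientation → Finset G.edgeSet) {K : Type*} [CommRing K]
    (k₁ k₂ l m x w x' w' y z y' z' : K) : K :=
  ∑ O : G.Fourientation,
    k₁ ^ (O.ori ∩ φ O).card * k₂ ^ (O.ori \ φ O).card * l ^ O.unor.card * m ^ O.bior.card *
    x ^ (I O ∩ O.pos).card * w ^ (I O ∩ O.neg).card *
    x' ^ (I O ∩ O.bior).card * w' ^ (I O ∩ O.unor).card *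
    y ^ (L O ∩ O.pos).card * z ^ (L O ∩ O.neg).card *
    y' ^ (L O ∩ O.unor).card * z' ^ (L O ∩ O.bior).card

variable (G) in
/-- The Gordon–Traldi sum over spanning subgraphs. -/
def gordonTraldiSum {K : Type*} [CommRing K] (x' w' y' z' : K) : K :=
  ∑ S : Finset G.edgeSet,
    x' ^ (G.genCutAct S ∩ S).card * w' ^ (G.genCutAct S \ S).card *
    y' ^ (G.genCycleAct S \ S).card * z' ^ (G.genCycleAct S ∩ S).card

open Classical in
/-- The Las Vergnas sum over orientations. -/
def lasVergnasSum (R : G.RefOrientation) {K : Type*} [CommRing K] (x w y z : K) : K :=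
  ∑ O : G.Fourientation with O.IsOrientation,
    x ^ (O.orientationCutAct R ∩ O.pos).card * w ^ (O.orientationCutAct R ∩ O.neg).card *
    y ^ (O.orientationCycleAct R ∩ O.pos).card * z ^ (O.orientationCycleAct R ∩ O.neg).card

end Activities

end

end Graph

/-! Everything is expressed through reachability. A directed edge `d` is the minimum of a potential
cut of `O` exactly if no walk returns from its end to its beginning along `O` and arbitrary smaller
edges (`exists_potentialCut_iff`). It is the minimum of a potential cycle exactly if it is in `O`
and such a walk exists in `O` without smaller edges and without `d.rev`
(`exists_potentialCycle_iff`). Generalized activities of subgraphs obey the undirected analogues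
(`mem_genCutAct_iff`, `mem_genCycleAct_iff`).

The map `φ` is `subgraph`: the simply oriented edges are made unoriented (deletion) or bioriented
(contraction) one at a time, the largest first. Let `Q` be the fourientation without the edge `e` in
question. Adding a direction of `e` to `Q` affects another edge only by blocking a cut activity or
opening a cycle activity, through a walk along that direction. If both directions of `e` had an
effect, the walks could be spliced into a return walk that avoids `e`, which is contradictory
(`isNeutral_or_isNeutral_rev`). So one direction is neutral and acts like deletion; since the
effects of the two directions simply add up, the opposite one acts like contraction. If `e` itself
is active, both directions are neutral, and the free choice is used to obtain the prescribed signs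
(`exists_sign_isNeutral`). When the turn of an edge comes, all larger edges are unoriented or
bioriented and the smaller ones count in both directions or not at all, so its activity is already
that of the final subgraph. The choice at `e` depends only on the other edges, so the process can be
reversed once the set of simply oriented edges is known; this gives the bijection.

For the polynomial identities, adding or removing active edges changes no activity, so the
Gordon–Traldi sum depends only on `x + w` and `y + z`. A greedy count of components identifies one
specialization with the Tutte polynomial (`tutte_eq_gordonTraldiSum`). Under the bijection, the sum
over fourientations becomes a double sum over `S = φ O` and `A = O.ori`; the sum over `A` factors
over the edges (`sum_activity_monomials`) and yields a rescaled Gordon–Traldi term. -/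

namespace Graph

variable {α β : Type*} {G : Graph α β}

/-! ### Directed reachability -/

/-- The directed edge opposite to `d`. -/
def DirEdge.rev (d : G.DirEdge) : G.DirEdge := (d.1, !d.2)

@[simp] lemma DirEdge.rev_fst (d : G.DirEdge) : d.rev.1 = d.1 := rfl

@[simp] lemma DirEdge.rev_rev (d : G.DirEdge) : d.rev.rev = d := by
  simp [DirEdge.rev]

lemma DirEdge.rev_ne (d : G.DirEdge) : d.rev ≠ d := by
  obtain ⟨e, b⟩ := d
  cases b <;> simp [DirEdge.rev]

lemma DirEdge.eq_or_eq_rev {c d : G.DirEdge} (h : c.1 = d.1) : c = d ∨ c = d.rev := by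
  obtain ⟨e, b⟩ := d
  obtain ⟨e', b'⟩ := c
  obtain rfl : e' = e := h
  cases b <;> cases b' <;> simp [DirEdge.rev]

@[simp] lemma RefOrientation.src_rev (R : G.RefOrientation) (d : G.DirEdge) :
    R.src d.rev = R.tgt d := by
  obtain ⟨e, b⟩ := d
  cases b <;> rfl

@[simp] lemma RefOrientation.tgt_rev (R : G.RefOrientation) (d : G.DirEdge) :
    R.tgt d.rev = R.src d := by
  obtain ⟨e, b⟩ := d
  cases b <;> rfl

/-- There is a directed walk from `u` to `v` all of whose directed edges are in `A`. -/
def Reach (R : G.RefOrientation) (A : Set G.DirEdge) : G.vertexSet → G.vertexSet → Prop :=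
  Relation.ReflTransGen fun u v => ∃ d ∈ A, R.src d = u ∧ R.tgt d = v

variable {R : G.RefOrientation} {A B : Set G.DirEdge} {u v w : G.vertexSet} {d : G.DirEdge}

lemma Reach.refl : Reach R A u u := Relation.ReflTransGen.refl

lemma Reach.trans (h : Reach R A u v) (h' : Reach R A v w) : Reach R A u w :=
  Relation.ReflTransGen.trans h h'

lemma Reach.mono (h : Reach R A u v) (hAB : A ⊆ B) : Reach R B u v :=
  Relation.ReflTransGen.mono (fun _ _ ⟨d, hd, hd'⟩ => ⟨d, hAB hd, hd'⟩) _ _ h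

lemma Reach.of_mem (h : d ∈ A) : Reach R A (R.src d) (R.tgt d) :=
  Relation.ReflTransGen.single ⟨d, h, rfl, rfl⟩

lemma Reach.mem_of_closed {X : Set G.vertexSet} (h : Reach R A u v)
    (hX : ∀ d ∈ A, R.src d ∈ X → R.tgt d ∈ X) (hu : u ∈ X) : v ∈ X := by
  induction h with
  | refl => exact hu
  | tail _ h ih =>
    obtain ⟨d, hd, rfl, rfl⟩ := h
    exact hX d hd ih

lemma Reach.symm (h : Reach R A u v) (hA : ∀ d ∈ A, d.rev ∈ A) : Reach R A v u := by
  induction h with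
  | refl => exact Reach.refl
  | tail _ h ih =>
    obtain ⟨d, hd, rfl, rfl⟩ := h
    have h := Reach.of_mem (R := R) (hA d hd)
    rw [R.src_rev, R.tgt_rev] at h
    exact h.trans ih

lemma reach_insert_iff : Reach R (insert d A) u v ↔
    Reach R A u v ∨ Reach R A u (R.src d) ∧ Reach R A (R.tgt d) v := by
  constructor
  · intro h
    induction h with
    | refl => exact Or.inl Reach.refl
    | tail _ h ih =>
      obtain ⟨c, rfl | hc, rfl, rfl⟩ := h
      · rcases ih with ih | ih
        · exact Or.inr ⟨ih, Reach.refl⟩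
        · exact Or.inr ⟨ih.1, Reach.refl⟩
      · rcases ih with ih | ih
        · exact Or.inl (ih.trans (Reach.of_mem hc))
        · exact Or.inr ⟨ih.1, ih.2.trans (Reach.of_mem hc)⟩
  · have hA : A ⊆ insert d A := Set.subset_insert d A
    rintro (h | ⟨h, h'⟩)
    · exact h.mono hA
    · exact ((h.mono hA).trans (Reach.of_mem (Set.mem_insert d A))).trans (h'.mono hA)

/-- Whether one can return from the end of `d` to its beginning does not depend on `d`. -/
lemma reach_insert_return :
    Reach R (insert d A) (R.tgt d) (R.src d) ↔ Reach R A (R.tgt d) (R.src d) := by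
  rw [reach_insert_iff]
  tauto

/-- Traversing `d` and later `d.rev` returns to the same vertex, so a walk needs the new edge at
most once. -/
lemma reach_insert_insert_rev_iff : Reach R (insert d (insert d.rev A)) u v ↔
    Reach R A u v ∨ Reach R A u (R.src d) ∧ Reach R A (R.tgt d) v ∨
      Reach R A u (R.tgt d) ∧ Reach R A (R.src d) v := by
  simp only [reach_insert_iff, R.src_rev, R.tgt_rev]
  constructor
  · rintro ((h | h) | ⟨h1 | h1, h2 | h2⟩)
    · exact Or.inl h
    · exact Or.inr (Or.inr h)
    · exact Or.inr (Or.inl ⟨h1, h2⟩)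
    · exact Or.inl (h1.trans h2.2)
    · exact Or.inl (h1.1.trans h2)
    · exact Or.inr (Or.inr ⟨h1.1, h2.2⟩)
  · tauto

/-- The two directions of the edges in `T`. -/
def dirEdges (T : Set G.edgeSet) : Set G.DirEdge := {d | d.1 ∈ T}

@[simp] lemma mem_dirEdges {T : Set G.edgeSet} : d ∈ dirEdges T ↔ d.1 ∈ T := Iff.rfl

lemma dirEdges_mono {S T : Set G.edgeSet} (h : S ⊆ T) : dirEdges S ⊆ dirEdges T :=
  fun _ hd => h hd

lemma dirEdges_insert (T : Set G.edgeSet) (d : G.DirEdge) :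
    dirEdges (insert d.1 T) = insert d (insert d.rev (dirEdges T)) := by
  ext c
  simp only [mem_dirEdges, Set.mem_insert_iff]
  constructor
  · rintro (h | h)
    · rcases DirEdge.eq_or_eq_rev h with h | h <;> simp [h]
    · simp [h]
  · rintro (rfl | rfl | h) <;> simp [*]

lemma Reach.symm_dirEdges {T : Set G.edgeSet} (h : Reach R (dirEdges T) u v) :
    Reach R (dirEdges T) v u :=
  h.symm fun _ hd => hd

/-! ### Connected components -/

lemma isLink_iff_exists_dirEdge (R : G.RefOrientation) (e : G.edgeSet) :
    G.IsLink e u v ↔ ∃ d : G.DirEdge, d.1 = e ∧ R.src d = u ∧ R.tgt d = v := by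
  constructor
  · intro h
    rcases h.eq_and_eq_or_eq_and_eq (R.isLink e) with ⟨h1, h2⟩ | ⟨h1, h2⟩
    · exact ⟨(e, true), rfl, Subtype.ext h1.symm, Subtype.ext h2.symm⟩
    · exact ⟨(e, false), rfl, Subtype.ext h1.symm, Subtype.ext h2.symm⟩
  · rintro ⟨⟨e, b⟩, rfl, rfl, rfl⟩
    cases b
    · exact (R.isLink e).symm
    · exact R.isLink e

lemma quot_mk_eq_iff_reach (R : G.RefOrientation) (S : Finset G.edgeSet) :
    Quot.mk (fun x y : G.vertexSet => ∃ e ∈ S, G.IsLink e x y) u = Quot.mk _ v ↔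
      Reach R (dirEdges S) u v := by
  rw [Quot.eq]
  constructor
  · intro h
    induction h with
    | rel x y h =>
      obtain ⟨e, he, h⟩ := h
      obtain ⟨d, rfl, rfl, rfl⟩ := (isLink_iff_exists_dirEdge R e).1 h
      exact Reach.of_mem he
    | refl x => exact Reach.refl
    | symm x y _ ih => exact ih.symm_dirEdges
    | trans x y z _ _ ih ih' => exact ih.trans ih'
  · intro h
    induction h with
    | refl => exact Relation.EqvGen.refl _
    | tail _ h ih =>
      obtain ⟨d, hd, rfl, rfl⟩ := h
      exact ih.trans _ _ _ (Relation.EqvGen.rel _ _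
        ⟨d.1, hd, (isLink_iff_exists_dirEdge R d.1).2 ⟨d, rfl, rfl, rfl⟩⟩)

/-- The map from components of a smaller subgraph to components of a larger one. -/
def componentMap {S T : Finset G.edgeSet} (h : S ⊆ T) :
    Quot (fun x y : G.vertexSet => ∃ e ∈ S, G.IsLink e x y) →
      Quot (fun x y : G.vertexSet => ∃ e ∈ T, G.IsLink e x y) :=
  Quot.map id fun _ _ ⟨e, he, h'⟩ => ⟨e, h he, h'⟩

lemma componentMap_surjective {S T : Finset G.edgeSet} (h : S ⊆ T) :
    Function.Surjective (componentMap h) := by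
  rintro ⟨x⟩
  exact ⟨Quot.mk _ x, rfl⟩

lemma numComponents_empty [Fintype G.vertexSet] :
    G.numComponents ∅ = Fintype.card G.vertexSet := by
  rw [numComponents, ← Nat.card_eq_fintype_card]
  symm
  refine Nat.card_eq_of_bijective (Quot.mk _) ⟨fun x y h => ?_, Quot.mk_surjective⟩
  replace h := Quot.eqvGen_exact h
  induction h with
  | rel x y h =>
    obtain ⟨e, he, _⟩ := h
    simp at he
  | refl => rfl
  | symm _ _ _ ih => exact ih.symm
  | trans _ _ _ _ _ ih ih' => exact ih.trans ih'

/-- The map between the finite sets of components is surjective, so the numbers agree exactly if it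
is injective, that is, if every edge of `T` has its ends connected by `S`. -/
lemma numComponents_lt_iff [Finite G.vertexSet] (R : G.RefOrientation) {S T : Finset G.edgeSet}
    (h : S ⊆ T) : G.numComponents T < G.numComponents S ↔
      ∃ d : G.DirEdge, d.1 ∈ T ∧ ¬ Reach R (dirEdges S) (R.src d) (R.tgt d) := by
  have hle : G.numComponents T ≤ G.numComponents S :=
    Nat.card_le_card_of_surjective _ (componentMap_surjective h)
  have hbij : Function.Bijective (componentMap h) ↔ G.numComponents S = G.numComponents T := by
    rw [Nat.bijective_iff_surjective_and_card]
    exact and_iff_right (componentMap_surjective h)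
  constructor
  · intro hlt
    by_contra! hcon
    refine hlt.ne' (hbij.1 ⟨?_, componentMap_surjective h⟩)
    rintro ⟨x⟩ ⟨y⟩ hxy
    have hxy : Reach R (dirEdges T) x y := (quot_mk_eq_iff_reach R T).1 hxy
    refine (quot_mk_eq_iff_reach R S).2 ?_
    exact hxy.mem_of_closed (X := {z | Reach R (dirEdges S) x z})
      (fun d hd hx => Reach.trans hx (hcon d hd)) Reach.refl
  · rintro ⟨d, hd, hd'⟩
    refine lt_of_le_of_ne hle fun heq => hd' ?_
    refine (quot_mk_eq_iff_reach R S).1 ((hbij.2 heq.symm).1 ?_)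
    exact (quot_mk_eq_iff_reach R T).2 (Reach.of_mem hd)

lemma numComponents_insert_of_reach [Finite G.vertexSet] [DecidableEq G.edgeSet]
    (S : Finset G.edgeSet) (d : G.DirEdge) (h : Reach R (dirEdges S) (R.tgt d) (R.src d)) :
    G.numComponents (insert d.1 S) = G.numComponents S := by
  have hsub : S ⊆ insert d.1 S := Finset.subset_insert _ _
  refine le_antisymm (Nat.card_le_card_of_surjective _ (componentMap_surjective hsub)) ?_
  by_contra! hlt
  obtain ⟨c, hc, hc'⟩ := (numComponents_lt_iff R hsub).1 hlt
  rcases Finset.mem_insert.1 hc with hc | hc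
  · rcases DirEdge.eq_or_eq_rev hc with rfl | rfl
    · exact hc' h.symm_dirEdges
    · rw [R.src_rev, R.tgt_rev] at hc'
      exact hc' h
  · exact hc' (Reach.of_mem hc)

lemma numComponents_insert_of_not_reach [Finite G.vertexSet] [DecidableEq G.edgeSet]
    (S : Finset G.edgeSet) (d : G.DirEdge) (h : ¬ Reach R (dirEdges S) (R.tgt d) (R.src d)) :
    G.numComponents S = G.numComponents (insert d.1 S) + 1 := by
  have hsub : S ⊆ insert d.1 S := Finset.subset_insert _ _
  let r := fun x y : G.vertexSet => ∃ e ∈ S, G.IsLink e x y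
  let q : Quot r := Quot.mk r (R.tgt d)
  have key : ∀ x y, Reach R (dirEdges (insert d.1 S : Finset G.edgeSet)) x y ↔
      Reach R (dirEdges S) x y ∨
        Reach R (dirEdges S) x (R.src d) ∧ Reach R (dirEdges S) (R.tgt d) y ∨
        Reach R (dirEdges S) x (R.tgt d) ∧ Reach R (dirEdges S) (R.src d) y := by
    intro x y
    rw [Finset.coe_insert, dirEdges_insert, reach_insert_insert_rev_iff]
  -- The only identification is that of the components of the two ends of `d`; leaving out one of
  -- them makes the map bijective.
  have hbij : Function.Bijective (fun p : {p : Quot r // p ≠ q} => componentMap hsub p.1) := by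
    constructor
    · rintro ⟨⟨x⟩, hx⟩ ⟨⟨y⟩, hy⟩ hxy
      refine Subtype.ext ((quot_mk_eq_iff_reach R S).2 ?_)
      have hx : ¬ Reach R (dirEdges S) x (R.tgt d) :=
        fun h' => hx ((quot_mk_eq_iff_reach R S).2 h')
      have hy : ¬ Reach R (dirEdges S) y (R.tgt d) :=
        fun h' => hy ((quot_mk_eq_iff_reach R S).2 h')
      rcases (key x y).1 ((quot_mk_eq_iff_reach R _).1 hxy) with h' | h' | h'
      · exact h'
      · exact absurd h'.2.symm_dirEdges hy
      · exact absurd h'.1 hx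
    · rintro ⟨x⟩
      by_cases hx : Reach R (dirEdges S) x (R.tgt d)
      · refine ⟨⟨Quot.mk r (R.src d), fun h' => h ?_⟩, ?_⟩
        · exact ((quot_mk_eq_iff_reach R S).1 h').symm_dirEdges
        · refine (quot_mk_eq_iff_reach R _).2 ((key _ _).2 (Or.inr (Or.inl ⟨Reach.refl, ?_⟩)))
          exact hx.symm_dirEdges
      · exact ⟨⟨Quot.mk r x, fun h' => hx ((quot_mk_eq_iff_reach R S).1 h')⟩, rfl⟩
  have h1 := Nat.card_eq_of_bijective _ hbij
  have h2 : Nat.card (Quot r) = Nat.card {p : Quot r // p ≠ q} + 1 := by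
    classical
    rw [← Finite.card_option]
    exact Nat.card_congr (Equiv.optionSubtypeNe q).symm
  rw [numComponents, numComponents, ← h1, ← h2]

end Graph

namespace Graph

variable {α β : Type*} {G : Graph α β} {R : G.RefOrientation}

/-! ### Cuts -/

section Edges

variable [LinearOrder G.edgeSet]

lemma mem_edges_iff {D : Finset G.DirEdge} {d : G.DirEdge} :
    d.1 ∈ edges D ↔ d ∈ D ∨ d.rev ∈ D := by
  simp only [edges, Finset.mem_image]
  constructor
  · rintro ⟨c, hc, h⟩
    rcases DirEdge.eq_or_eq_rev h with rfl | rfl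
    · exact Or.inl hc
    · exact Or.inr hc
  · rintro (h | h)
    · exact ⟨d, h, rfl⟩
    · exact ⟨d.rev, h, rfl⟩

lemma mem_edges_of_mem {D : Finset G.DirEdge} {d : G.DirEdge} (h : d ∈ D) : d.1 ∈ edges D :=
  mem_edges_iff.2 (Or.inl h)

lemma edges_subset_iff {D : Finset G.DirEdge} {S : Finset G.edgeSet} :
    edges D ⊆ S ↔ ∀ d ∈ D, d.1 ∈ S := by
  simp only [edges, Finset.image_subset_iff]

lemma exists_mem_of_mem_edges {D : Finset G.DirEdge} {e : G.edgeSet} (h : e ∈ edges D) :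
    ∃ d ∈ D, d.1 = e := by
  simpa only [edges, Finset.mem_image] using h

end Edges

section Cuts

variable [Fintype G.edgeSet]

open Classical in
/-- The directed edges that leave the vertex set `X`. -/
noncomputable def leaving (R : G.RefOrientation) (X : Set G.vertexSet) : Finset G.DirEdge :=
  Finset.univ.filter fun d => R.src d ∈ X ∧ R.tgt d ∉ X

@[simp] lemma mem_leaving {X : Set G.vertexSet} {d : G.DirEdge} :
    d ∈ leaving R X ↔ R.src d ∈ X ∧ R.tgt d ∉ X := by
  simp [leaving]

variable [LinearOrder G.edgeSet]

lemma mem_edges_leaving {X : Set G.vertexSet} {d : G.DirEdge} :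
    d.1 ∈ edges (leaving R X) ↔ ¬ (R.src d ∈ X ↔ R.tgt d ∈ X) := by
  rw [mem_edges_iff, mem_leaving, mem_leaving, R.src_rev, R.tgt_rev]
  tauto

variable [Fintype G.vertexSet]

lemma numComponents_lt_compl_iff (R : G.RefOrientation) (S : Finset G.edgeSet) :
    G.numComponents Finset.univ < G.numComponents Sᶜ ↔
      ∃ X, (leaving R X).Nonempty ∧ edges (leaving R X) ⊆ S := by
  rw [numComponents_lt_iff R (Finset.subset_univ _)]
  constructor
  · rintro ⟨d, -, hd⟩
    -- The component of `R.src d` after the removal of `S` can be left only through `S`.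
    refine ⟨{v | Reach R (dirEdges (Sᶜ : Finset G.edgeSet)) (R.src d) v},
      ⟨d, mem_leaving.2 ⟨Reach.refl, hd⟩⟩, edges_subset_iff.2 fun c hc => ?_⟩
    obtain ⟨hc1, hc2⟩ := mem_leaving.1 hc
    by_contra hS
    exact hc2 (Reach.trans hc1 (Reach.of_mem (by simpa using hS)))
  · rintro ⟨X, ⟨d, hd⟩, hX⟩
    obtain ⟨hd1, hd2⟩ := mem_leaving.1 hd
    refine ⟨d, Finset.mem_univ _, fun h => hd2 (h.mem_of_closed (fun c hc hcX => ?_) hd1)⟩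
    by_contra hcX'
    have hc' : c.1 ∉ S := by simpa using hc
    exact hc' (edges_subset_iff.1 hX c (mem_leaving.2 ⟨hcX, hcX'⟩))

lemma IsCut.exists_eq_edges_leaving {C : Finset G.edgeSet} (hC : G.IsCut C)
    (R : G.RefOrientation) : ∃ X, C = edges (leaving R X) := by
  obtain ⟨X, ⟨d, hd⟩, hX⟩ := (numComponents_lt_compl_iff R C).1 hC.prop.2
  refine ⟨X, le_antisymm (hC.2 ⟨⟨d.1, mem_edges_of_mem hd⟩, ?_⟩ hX) hX⟩
  exact (numComponents_lt_compl_iff R _).2 ⟨X, ⟨d, hd⟩, subset_rfl⟩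

/-- The edges leaving `X` form a cut if no other vertex set separates the ends of `d` with fewer
leaving edges. -/
lemma isCut_edges_leaving_of_minimal {X : Set G.vertexSet} {d : G.DirEdge} (hd : d ∈ leaving R X)
    (hX : ∀ Y, d ∈ leaving R Y → leaving R Y ⊆ leaving R X → leaving R X ⊆ leaving R Y) :
    G.IsCut (edges (leaving R X)) := by
  refine ⟨⟨⟨d.1, mem_edges_of_mem hd⟩,
    (numComponents_lt_compl_iff R _).2 ⟨X, ⟨d, hd⟩, subset_rfl⟩⟩, ?_⟩
  rintro S ⟨-, hS⟩ hSX
  obtain ⟨Y, ⟨c, hc⟩, hYS⟩ := (numComponents_lt_compl_iff R S).1 hS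
  -- Passing to the complement separates the same edges, so `Y` may be assumed to contain the
  -- beginning of `d`.
  have hcross : ∃ Y : Set G.vertexSet, R.src d ∈ Y ∧ (∃ c, ¬ (R.src c ∈ Y ↔ R.tgt c ∈ Y)) ∧
      ∀ c, ¬ (R.src c ∈ Y ↔ R.tgt c ∈ Y) → c.1 ∈ S := by
    have h1 : ¬ (R.src c ∈ Y ↔ R.tgt c ∈ Y) := mem_edges_leaving.1 (mem_edges_of_mem hc)
    have h2 : ∀ c, ¬ (R.src c ∈ Y ↔ R.tgt c ∈ Y) → c.1 ∈ S :=
      fun c hc => hYS (mem_edges_leaving.2 hc)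
    by_cases hdY : R.src d ∈ Y
    · exact ⟨Y, hdY, ⟨c, h1⟩, h2⟩
    · refine ⟨Yᶜ, hdY, ⟨c, ?_⟩, fun c hc => h2 c ?_⟩
      · simpa only [Set.mem_compl_iff, not_iff_not] using h1
      · simpa only [Set.mem_compl_iff, not_iff_not] using hc
  clear hc hYS c Y
  obtain ⟨Y, hdY, ⟨c, hc⟩, hY⟩ := hcross
  have hYX : ∀ c, ¬ (R.src c ∈ Y ↔ R.tgt c ∈ Y) → ¬ (R.src c ∈ X ↔ R.tgt c ∈ X) :=
    fun c hc => mem_edges_leaving.1 (hSX (hY c hc))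
  obtain ⟨hd1, hd2⟩ := mem_leaving.1 hd
  -- Uncrossing: edges separated by `Y` are separated by `X`, so whatever leaves `X ∩ Y` leaves `X`,
  -- and minimality applies to `X ∩ Y`. The same works below for unions.
  have hsrc : ∀ c ∈ leaving R X, R.src c ∈ Y := by
    intro c hc
    have h := hX (X ∩ Y) (mem_leaving.2 ⟨⟨hd1, hdY⟩, fun h => hd2 h.1⟩) ?_ hc
    · exact (mem_leaving.1 h).1.2
    · intro c hc
      have := hYX c
      simp only [mem_leaving, Set.mem_inter_iff] at hc ⊢
      tauto
  by_cases hdY' : R.tgt d ∈ Y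
  -- Here the edges leaving `X` would lie entirely within `Y`, although `Y` separates at least one
  -- of them.
  · have htgt : ∀ c ∈ leaving R X, R.tgt c ∈ Y := by
      intro c hc
      have h := hX (X ∪ Yᶜ) (mem_leaving.2 ⟨Or.inl hd1, fun h => h.elim hd2 fun h => h hdY'⟩) ?_ hc
      · have := (mem_leaving.1 h).2
        simp only [Set.mem_union, Set.mem_compl_iff] at this
        tauto
      · intro c hc
        have := hYX c
        simp only [mem_leaving, Set.mem_union, Set.mem_compl_iff] at hc ⊢
        tauto
    rcases mem_edges_iff.1 (hSX (hY c hc)) with h | h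
    · have h1 := hsrc _ h
      have h2 := htgt _ h
      tauto
    · have h1 := hsrc _ h
      have h2 := htgt _ h
      rw [R.src_rev] at h1
      rw [R.tgt_rev] at h2
      tauto
  -- Here every edge leaving `X` is separated by `Y` and therefore is in `S`.
  · have htgt : ∀ c ∈ leaving R X, R.tgt c ∉ Y := by
      intro c hc
      have h := hX (X ∪ Y) (mem_leaving.2 ⟨Or.inl hd1, fun h => h.elim hd2 hdY'⟩) ?_ hc
      · have := (mem_leaving.1 h).2
        simp only [Set.mem_union] at this
        tauto
      · intro c hc
        have := hYX c
        simp only [mem_leaving, Set.mem_union] at hc ⊢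
        tauto
    refine edges_subset_iff.2 fun c hc => hY c ?_
    have h1 := hsrc _ hc
    have h2 := htgt _ hc
    tauto

lemma exists_isDirectedCut_subset {X : Set G.vertexSet} {d : G.DirEdge} (hd : d ∈ leaving R X) :
    ∃ D, IsDirectedCut R D ∧ d ∈ D ∧ D ⊆ leaving R X := by
  obtain ⟨D, ⟨⟨Y, rfl, hdY⟩, hYX⟩, hmin⟩ := exists_minimal_of_wellFoundedLT
    (fun D : Finset G.DirEdge => (∃ Y, D = leaving R Y ∧ d ∈ D) ∧ D ⊆ leaving R X)
    ⟨leaving R X, ⟨X, rfl, hd⟩, subset_rfl⟩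
  refine ⟨leaving R Y, ⟨isCut_edges_leaving_of_minimal hdY fun Z hdZ hZY => ?_, Y, by simp⟩,
    hdY, hYX⟩
  exact hmin ⟨⟨Z, rfl, hdZ⟩, hZY.trans hYX⟩ hZY

/-- An edge whose ends are separated by `X` is in a cut all of whose edges are separated
by `X`. -/
lemma exists_isCut_of_separated {X : Set G.vertexSet} {d : G.DirEdge}
    (hd : ¬ (R.src d ∈ X ↔ R.tgt d ∈ X)) :
    ∃ C, G.IsCut C ∧ d.1 ∈ C ∧ ∀ c : G.DirEdge, c.1 ∈ C → ¬ (R.src c ∈ X ↔ R.tgt c ∈ X) := by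
  rcases mem_edges_iff.1 (mem_edges_leaving.2 hd) with h | h
  all_goals
    obtain ⟨D, hD, hdD, hDX⟩ := exists_isDirectedCut_subset h
    refine ⟨edges D, hD.1, ?_, fun c hc => mem_edges_leaving.1 ?_⟩
    · exact mem_edges_iff.2 (by simp [hdD])
    exact Finset.image_subset_image hDX hc

/-- A potential cut with minimum edge `d` exists unless one can return from the end of `d` to its
beginning, using smaller edges in both directions. -/
theorem exists_potentialCut_iff (O : G.Fourientation) (d : G.DirEdge) :
    (∃ D, IsPotentialCut R O D ∧ IsMinEdge d.1 D ∧ d ∈ D) ↔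
      ¬ Reach R ((O : Set G.DirEdge) ∪ dirEdges (Set.Iio d.1))
        (R.tgt d) (R.src d) := by
  constructor
  · rintro ⟨D, ⟨⟨-, X, hX⟩, hpot⟩, hmin, hdD⟩ hreach
    -- A walk cannot enter `X`: an entering edge is the reverse of one in `D`, so it is neither in
    -- `O` nor smaller than `d`.
    refine hreach.mem_of_closed (X := Xᶜ) ?_ ((hX d).1 hdD).2 ((hX d).1 hdD).1
    rintro c (hc | hc) hsrc htgt
    · have hcD : c.rev ∈ D := (hX _).2 (by simpa using ⟨htgt, hsrc⟩)
      have := hpot _ hcD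
      change c.rev.rev ∉ _ at this
      rw [DirEdge.rev_rev] at this
      exact this hc
    · have hcD : c.rev ∈ D := (hX _).2 (by simpa using ⟨htgt, hsrc⟩)
      exact absurd (hmin.2 (mem_edges_of_mem hcD)) (not_le.2 hc)
  · intro h
    set A : Set G.DirEdge := (O : Set G.DirEdge) ∪ dirEdges (Set.Iio d.1) with hA
    -- The cut is taken at the boundary of the set reachable from the end of `d`, directed into that
    -- set.
    obtain ⟨D, hD, hdD, hDX⟩ := exists_isDirectedCut_subset (R := R)
      (X := {v | Reach R A (R.tgt d) v}ᶜ) (d := d)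
      (mem_leaving.2 ⟨h, fun h' => h' Reach.refl⟩)
    have key : ∀ c ∈ D, c.rev ∉ A := by
      intro c hc hcA
      obtain ⟨h1, h2⟩ := mem_leaving.1 (hDX hc)
      have h3 := Reach.of_mem (R := R) hcA
      rw [R.src_rev, R.tgt_rev] at h3
      exact h1 (Reach.trans (not_not.1 h2) h3)
    refine ⟨D, ⟨hD, fun c hc hcO => key c hc (Or.inl hcO)⟩, ⟨mem_edges_of_mem hdD, ?_⟩, hdD⟩
    intro e he
    obtain ⟨c, hc, rfl⟩ := exists_mem_of_mem_edges (Finset.mem_coe.1 he)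
    exact not_lt.1 fun hlt => key c hc (Or.inr hlt)

end Cuts

end Graph

namespace Graph

variable {α β : Type*} {G : Graph α β} {R : G.RefOrientation}

/-! ### Directed paths and cycles -/

section Paths

variable [DecidableEq G.edgeSet]

/-- `IsDirPath R u D W v`: `D` is the set of directed edges and `W` the set of vertices of a
directed path from `u` to `v`. -/
inductive IsDirPath (R : G.RefOrientation) :
    G.vertexSet → Finset G.DirEdge → Set G.vertexSet → G.vertexSet → Prop
  | nil (v : G.vertexSet) : IsDirPath R v ∅ {v} v
  | cons {D : Finset G.DirEdge} {W : Set G.vertexSet} {v : G.vertexSet} (d : G.DirEdge)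
      (h : IsDirPath R (R.tgt d) D W v) (hd : R.src d ∉ W) :
      IsDirPath R (R.src d) (insert d D) (insert (R.src d) W) v

variable {D : Finset G.DirEdge} {W : Set G.vertexSet} {u v : G.vertexSet}

lemma IsDirPath.start_mem (h : IsDirPath R u D W v) : u ∈ W := by
  cases h <;> simp

lemma IsDirPath.end_mem (h : IsDirPath R u D W v) : v ∈ W := by
  induction h with
  | nil => simp
  | cons d h hd ih => exact Or.inr ih

lemma IsDirPath.ends_mem (h : IsDirPath R u D W v) :
    ∀ d ∈ D, R.src d ∈ W ∧ R.tgt d ∈ W := by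
  induction h with
  | nil => simp
  | cons d h hd ih =>
    intro c hc
    rcases Finset.mem_insert.1 hc with rfl | hc
    · exact ⟨Or.inl rfl, Or.inr h.start_mem⟩
    · exact ⟨Or.inr (ih c hc).1, Or.inr (ih c hc).2⟩

lemma IsDirPath.exists_suffix (h : IsDirPath R u D W v) :
    ∀ w ∈ W, ∃ D' W', IsDirPath R w D' W' v ∧ D' ⊆ D := by
  induction h with
  | nil v =>
    rintro w rfl
    exact ⟨∅, {w}, .nil w, subset_rfl⟩
  | cons d h hd ih =>
    rintro w (rfl | hw)
    · exact ⟨_, _, .cons d h hd, subset_rfl⟩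
    · obtain ⟨D', W', h', hD'⟩ := ih w hw
      exact ⟨D', W', h', hD'.trans (Finset.subset_insert _ _)⟩

lemma Reach.exists_isDirPath {A : Set G.DirEdge} (h : Reach R A u v) :
    ∃ D W, IsDirPath R u D W v ∧ ↑D ⊆ A := by
  induction h using Relation.ReflTransGen.head_induction_on with
  | refl => exact ⟨∅, {v}, .nil v, by simp⟩
  | head h' _ ih =>
    obtain ⟨d, hd, rfl, rfl⟩ := h'
    obtain ⟨D, W, h, hD⟩ := ih
    by_cases hW : R.src d ∈ W
    · obtain ⟨D', W', h', hD'⟩ := h.exists_suffix _ hW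
      exact ⟨D', W', h', (Finset.coe_subset.2 hD').trans hD⟩
    · refine ⟨_, _, .cons d h hW, ?_⟩
      rw [Finset.coe_insert]
      exact Set.insert_subset hd hD

/-- Each edge of a path is the only one that is separated by the set of vertices after it. -/
lemma IsDirPath.exists_separating (h : IsDirPath R u D W v) :
    ∀ d ∈ D, ∃ X ⊆ W, v ∈ X ∧ u ∉ X ∧ R.src d ∉ X ∧ R.tgt d ∈ X ∧
      ∀ c ∈ D, c ≠ d → (R.src c ∈ X ↔ R.tgt c ∈ X) := by
  induction h with
  | nil => simp
  | @cons D W v d h hd ih =>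
    intro c hc
    by_cases hcd : c = d
    · subst hcd
      refine ⟨W, Set.subset_insert _ _, h.end_mem, hd, hd, h.start_mem, fun c' hc' hne => ?_⟩
      have := h.ends_mem c' ((Finset.mem_insert.1 hc').resolve_left hne)
      tauto
    · obtain ⟨X, hXW, hv, hu, h1, h2, h3⟩ := ih c ((Finset.mem_insert.1 hc).resolve_left hcd)
      have hdX : R.src d ∉ X := fun h' => hd (hXW h')
      refine ⟨X, hXW.trans (Set.subset_insert _ _), hv, hdX, h1, h2, fun c' hc' hne => ?_⟩
      rcases Finset.mem_insert.1 hc' with rfl | hc'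
      · tauto
      · exact h3 c' hc' hne

-- A path is balanced except at its ends, and one more edge from `v` to `u` restores the balance.
open Classical in
lemma IsDirPath.balance (h : IsDirPath R u D W v) (w : G.vertexSet) :
    (D.filter fun d => R.src d = w).card + (if v = w then 1 else 0) =
      (D.filter fun d => R.tgt d = w).card + (if u = w then 1 else 0) := by
  induction h with
  | nil => simp
  | @cons D W v d h hd ih =>
    have hdD : d ∉ D := fun h' => hd (h.ends_mem d h').1
    rw [Finset.filter_insert, Finset.filter_insert]
    split_ifs at ih ⊢ <;> simp_all

end Paths

section Cycles

open Classical in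
/-- If every vertex is entered as often as it is left, then a vertex set that is left
is also entered. -/
lemma exists_entering_of_balanced {D : Finset G.DirEdge} [Fintype G.vertexSet]
    (hD : ∀ v : G.vertexSet,
      (D.filter fun d => R.src d = v).card = (D.filter fun d => R.tgt d = v).card)
    {X : Set G.vertexSet} {d : G.DirEdge} (hd : d ∈ D) (h1 : R.src d ∈ X) (h2 : R.tgt d ∉ X) :
    ∃ c ∈ D, R.src c ∉ X ∧ R.tgt c ∈ X := by
  by_contra! hcon
  -- Summing the balance over `X`. If nothing entered `X`, the edges ending in `X` would be a proper
  -- subset of those starting in `X`, because of `d`.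
  have key : (D.filter fun d => R.src d ∈ X).card = (D.filter fun d => R.tgt d ∈ X).card := by
    have hfib : ∀ f : G.DirEdge → G.vertexSet, (D.filter fun d => f d ∈ X).card =
        ∑ v : G.vertexSet with v ∈ X, (D.filter fun d => f d = v).card := by
      intro f
      rw [Finset.card_eq_sum_card_fiberwise (f := f) (t := Finset.univ.filter (· ∈ X))
        (fun d hd => by simpa using (Finset.mem_filter.1 hd).2)]
      refine Finset.sum_congr rfl fun v hv => ?_
      rw [Finset.filter_filter]
      refine congrArg Finset.card (Finset.filter_congr fun d _ => ?_)
      have := (Finset.mem_filter.1 hv).2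
      constructor
      · exact fun h => h.2
      · rintro rfl
        exact ⟨this, rfl⟩
    rw [hfib, hfib]
    exact Finset.sum_congr rfl fun v _ => hD v
  refine key.not_gt (Finset.card_lt_card ⟨fun c hc => ?_, fun h => ?_⟩)
  · rw [Finset.mem_filter] at hc ⊢
    exact ⟨hc.1, by_contra fun h => hcon c hc.1 h hc.2⟩
  · exact h2 (Finset.mem_filter.1 (h (Finset.mem_filter.2 ⟨hd, h1⟩))).2

variable [Fintype G.vertexSet] [Fintype G.edgeSet] [LinearOrder G.edgeSet]

/-- A set of edges that can be closed up to a balanced set of directed edges, any two of which are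
separated by a vertex set that separates none of the others, is a cycle. -/
lemma isCycle_edges_of_separating {D : Finset G.DirEdge} (hne : D.Nonempty)
    (hdir : ∀ d ∈ D, d.rev ∉ D)
    (henter : ∀ X : Set G.vertexSet, ∀ d ∈ D, R.src d ∈ X → R.tgt d ∉ X →
      ∃ c ∈ D, R.src c ∉ X ∧ R.tgt c ∈ X)
    (hsep : ∀ d ∈ D, ∀ d' ∈ D, d ≠ d' → ∃ X : Set G.vertexSet, ¬ (R.src d ∈ X ↔ R.tgt d ∈ X) ∧
      ∀ c ∈ D, c ≠ d → c ≠ d' → (R.src c ∈ X ↔ R.tgt c ∈ X)) :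
    G.IsCycle (edges D) := by
  refine ⟨⟨?_, fun K hK hcard => ?_⟩, ?_⟩
  · obtain ⟨d, hd⟩ := hne
    exact ⟨d.1, mem_edges_of_mem hd⟩
  · obtain ⟨X, rfl⟩ := hK.exists_eq_edges_leaving R
    obtain ⟨e, he⟩ := Finset.card_eq_one.1 hcard
    have hmem : ∀ c ∈ D, ¬ (R.src c ∈ X ↔ R.tgt c ∈ X) → c.1 = e := by
      intro c hc hcX
      have : c.1 ∈ edges (leaving R X) ∩ edges D :=
        Finset.mem_inter.2 ⟨mem_edges_leaving.2 hcX, mem_edges_of_mem hc⟩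
      simpa [he] using this
    have heD : e ∈ edges (leaving R X) ∩ edges D := by simp [he]
    obtain ⟨h1, h2⟩ := Finset.mem_inter.1 heD
    obtain ⟨d, hd, rfl⟩ := exists_mem_of_mem_edges h2
    have hdX := mem_edges_leaving.1 h1
    have hcd : ∀ c ∈ D, ¬ (R.src c ∈ X ↔ R.tgt c ∈ X) → c = d := by
      intro c hc hcX
      refine (DirEdge.eq_or_eq_rev (hmem c hc hcX)).resolve_right ?_
      rintro rfl
      exact hdir d hd hc
    by_cases h : R.src d ∈ X
    · obtain ⟨c, hc, h3, h4⟩ := henter X d hd h (by tauto)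
      obtain rfl := hcd c hc (by tauto)
      exact h3 h
    · obtain ⟨c, hc, h3, h4⟩ := henter Xᶜ d hd h (by simp only [Set.mem_compl_iff]; tauto)
      simp only [Set.mem_compl_iff] at h3 h4
      obtain rfl := hcd c hc (by tauto)
      tauto
  · rintro S ⟨⟨e, he⟩, hS⟩ hSD
    refine edges_subset_iff.2 fun d' hd' => by_contra fun hd'S => ?_
    obtain ⟨d, hd, rfl⟩ := exists_mem_of_mem_edges (hSD he)
    obtain ⟨X, hX, hX'⟩ := hsep d hd d' hd' (by rintro rfl; exact hd'S he)
    -- Among the edges of `D`, this cut can contain only those of `d` and `d'`. As `d'` is not in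
    -- `S`, it meets `S` in `d` alone.
    obtain ⟨C, hC, hdC, hCX⟩ := exists_isCut_of_separated hX
    refine hS C hC (Finset.card_eq_one.2 ⟨d.1, ?_⟩)
    ext g
    rw [Finset.mem_inter, Finset.mem_singleton]
    constructor
    · rintro ⟨hgC, hgS⟩
      obtain ⟨c, hc, rfl⟩ := exists_mem_of_mem_edges (hSD hgS)
      by_contra hcd
      exact hCX c hgC (hX' c hc (fun h => hcd (congrArg _ h)) (by rintro rfl; exact hd'S hgS))
    · rintro rfl
      exact ⟨hdC, he⟩

/-- The cycle is a path, not just a walk, from the end of `d` to its beginning, closed by `d`. The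
assumption on `d.rev` excludes the path that runs straight back along `d`. -/
lemma exists_isDirectedCycle {A : Set G.DirEdge} {d : G.DirEdge}
    (h : Reach R A (R.tgt d) (R.src d)) (hd : d.rev ∉ A) :
    ∃ D, IsDirectedCycle R D ∧ d ∈ D ∧ ↑D ⊆ insert d A := by
  classical
  obtain ⟨P, W, hP, hPA⟩ := h.exists_isDirPath
  have hdP : d ∉ P := by
    intro hdP
    obtain ⟨X, -, h1, -, h2, -⟩ := hP.exists_separating d hdP
    exact h2 h1
  have hdir : ∀ c ∈ insert d P, c.rev ∉ insert d P := by
    have hdP' : d.rev ∉ P := fun h => hd (hPA h)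
    intro c hc hc'
    rcases Finset.mem_insert.1 hc with rfl | hc
    · exact hdP' ((Finset.mem_insert.1 hc').resolve_left (DirEdge.rev_ne _))
    rcases Finset.mem_insert.1 hc' with h' | hc'
    · rw [← h', DirEdge.rev_rev] at hdP'
      exact hdP' hc
    · obtain ⟨X, -, -, -, h1, h2, h3⟩ := hP.exists_separating c hc
      have := h3 _ hc' (DirEdge.rev_ne c)
      rw [R.src_rev, R.tgt_rev] at this
      exact h1 (this.1 h2)
  have hbal : ∀ v : G.vertexSet, ((insert d P).filter fun d => R.src d = v).card =
      ((insert d P).filter fun d => R.tgt d = v).card := by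
    intro v
    have := hP.balance v
    rw [Finset.filter_insert, Finset.filter_insert]
    split_ifs at this ⊢ <;> simp_all
  refine ⟨insert d P, ⟨isCycle_edges_of_separating (R := R) (Finset.insert_nonempty _ _) hdir
    (fun X c hc h1 h2 => exists_entering_of_balanced hbal hc h1 h2) ?_, ?_, ?_⟩,
    Finset.mem_insert_self _ _, ?_⟩
  · intro c hc c' hc' hne
    rcases Finset.mem_insert.1 hc with rfl | hc
    · have hc'P := (Finset.mem_insert.1 hc').resolve_left (Ne.symm hne)
      obtain ⟨X, -, h1, h2, -, -, h3⟩ := hP.exists_separating c' hc'P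
      refine ⟨X, by tauto, fun y hy hyc hyc' => ?_⟩
      exact h3 y ((Finset.mem_insert.1 hy).resolve_left hyc) hyc'
    obtain ⟨X, -, h1, h2, h3, h4, h5⟩ := hP.exists_separating c hc
    rcases Finset.mem_insert.1 hc' with rfl | hc'
    · refine ⟨X, by tauto, fun y hy hyc hyc' => ?_⟩
      exact h5 y ((Finset.mem_insert.1 hy).resolve_left hyc') hyc
    · obtain ⟨Y, -, k1, k2, k3, k4, k5⟩ := hP.exists_separating c' hc'
      -- Both `X` and `Y` separate the closing edge, so their symmetric difference does not; it
      -- separates only `c` and `c'`.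
      refine ⟨{v | ¬ (v ∈ X ↔ v ∈ Y)}, ?_, fun y hy hyc hyc' => ?_⟩
      · have := k5 c hc hne
        simp only [Set.mem_ofPred_eq]
        tauto
      · simp only [Set.mem_ofPred_eq]
        rcases Finset.mem_insert.1 hy with rfl | hy
        · tauto
        · have := k5 y hy hyc'
          have := h5 y hy hyc
          tauto
  · rintro e ⟨h1, h2⟩
    exact hdir _ h1 h2
  · intro v
    convert hbal v
  · rw [Finset.coe_insert]
    exact Set.insert_subset_insert hPA

/-- A potential cycle with minimum edge `d` exists if and only if one can return from the end of `d`
to its beginning without smaller edges. -/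
theorem exists_potentialCycle_iff (O : G.Fourientation) (d : G.DirEdge) :
    (∃ D, IsPotentialCycle R O D ∧ IsMinEdge d.1 D ∧ d ∈ D) ↔
      d ∈ O ∧ Reach R (((O : Set G.DirEdge) \ dirEdges (Set.Iio d.1)) \ {d.rev})
        (R.tgt d) (R.src d) := by
  set A : Set G.DirEdge := ((O : Set G.DirEdge) \ dirEdges (Set.Iio d.1)) \ {d.rev} with hA
  constructor
  · rintro ⟨D, ⟨⟨-, hdir, hbal⟩, hpot⟩, hmin, hdD⟩
    refine ⟨hpot d hdD, ?_⟩
    by_contra h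
    -- The edge `d` leaves the set of unreachable vertices, so another edge of `D` enters it from a
    -- reachable vertex and extends the walk.
    obtain ⟨c, hc, h1, h2⟩ := exists_entering_of_balanced hbal
      (X := {v | ¬ Reach R A (R.tgt d) v}) hdD h (fun h' => h' Reach.refl)
    refine h2 (Reach.trans (not_not.1 h1) (Reach.of_mem ⟨⟨hpot c hc, ?_⟩, ?_⟩))
    · exact not_lt.2 (hmin.2 (mem_edges_of_mem hc))
    · rintro rfl
      obtain ⟨e, b⟩ := d
      cases b
      · exact hdir e ⟨hc, hdD⟩
      · exact hdir e ⟨hdD, hc⟩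
  · rintro ⟨hdO, h⟩
    obtain ⟨D, hD, hdD, hDA⟩ := exists_isDirectedCycle h (fun h => h.2 rfl)
    refine ⟨D, ⟨hD, fun c hc => ?_⟩, ⟨mem_edges_of_mem hdD, fun e he => ?_⟩, hdD⟩
    · rcases hDA hc with rfl | h
      · exact hdO
      · exact h.1.1
    · obtain ⟨c, hc, rfl⟩ := exists_mem_of_mem_edges (Finset.mem_coe.1 he)
      rcases hDA hc with rfl | h
      · exact le_rfl
      · exact not_lt.1 h.1.2

end Cycles

end Graph

namespace Graph

variable {α β : Type*} {G : Graph α β} {R : G.RefOrientation}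

/-! ### Generalized activities of spanning subgraphs -/

lemma mem_reachable_iff {T : Set G.edgeSet} {u : G.vertexSet} {c : G.DirEdge} (hc : c.1 ∈ T) :
    Reach R (dirEdges T) u (R.src c) ↔ Reach R (dirEdges T) u (R.tgt c) :=
  ⟨fun h => h.trans (Reach.of_mem hc), fun h => h.trans (Reach.of_mem (d := c) hc).symm_dirEdges⟩

lemma reach_dirEdges_insert_of_reach {T : Set G.edgeSet} {u v : G.vertexSet} {d : G.DirEdge}
    (h : Reach R (dirEdges T) (R.tgt d) (R.src d)) :
    Reach R (dirEdges (insert d.1 T)) u v ↔ Reach R (dirEdges T) u v := by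
  rw [dirEdges_insert, reach_insert_insert_rev_iff]
  refine ⟨?_, Or.inl⟩
  rintro (h' | h' | h')
  · exact h'
  · exact h'.1.trans (h.symm_dirEdges.trans h'.2)
  · exact h'.1.trans (h.trans h'.2)

/-- A walk between the ends of `c` that used `d` would, closed up by `c`, connect the ends of `d`
within `T'`. -/
lemma reach_dirEdges_insert_of_not_reach {T T' : Set G.edgeSet} {c d : G.DirEdge}
    (h : ¬ Reach R (dirEdges T') (R.tgt d) (R.src d)) (hT : T ⊆ T') (hc : c.1 ∈ T') :
    Reach R (dirEdges (insert d.1 T)) (R.tgt c) (R.src c) ↔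
      Reach R (dirEdges T) (R.tgt c) (R.src c) := by
  rw [dirEdges_insert, reach_insert_insert_rev_iff]
  refine ⟨?_, Or.inl⟩
  have hc' : Reach R (dirEdges T') (R.src c) (R.tgt c) := Reach.of_mem hc
  rintro (h' | h' | h')
  · exact h'
  · exact absurd (((h'.2.mono (dirEdges_mono hT)).trans hc').trans
      (h'.1.mono (dirEdges_mono hT))) h
  · exact absurd (((h'.2.mono (dirEdges_mono hT)).trans hc').trans
      (h'.1.mono (dirEdges_mono hT))).symm_dirEdges h

variable [Fintype G.vertexSet] [Fintype G.edgeSet] [LinearOrder G.edgeSet]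

/-- The cut has to avoid the edges of `S` other than `d` and all smaller edges, so it exists exactly
if these do not connect the ends of `d`. -/
theorem mem_genCutAct_iff (R : G.RefOrientation) (S : Finset G.edgeSet) (d : G.DirEdge) :
    d.1 ∈ G.genCutAct S ↔
      ¬ Reach R (dirEdges ((↑S \ {d.1}) ∪ Set.Iio d.1)) (R.tgt d) (R.src d) := by
  simp only [genCutAct, Finset.mem_filter, Finset.mem_univ, true_and]
  constructor
  · rintro ⟨C, hC, hdisj, hmin⟩ h
    obtain ⟨X, rfl⟩ := hC.exists_eq_edges_leaving R
    have key : ∀ c ∈ dirEdges ((↑S \ {d.1}) ∪ Set.Iio d.1), (R.src c ∈ X ↔ R.tgt c ∈ X) := by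
      intro c hc
      by_contra hcX
      have hcX := mem_edges_leaving.2 hcX
      rcases hc with hc | hc
      · exact Finset.disjoint_left.1 hdisj hcX (by simpa using hc)
      · exact absurd (hmin.2 hcX) (not_le.2 hc)
    have hd := mem_edges_leaving.1 (Finset.mem_coe.1 hmin.1)
    by_cases ht : R.tgt d ∈ X
    · have := h.mem_of_closed (fun c hc => (key c hc).1) ht
      tauto
    · have := h.mem_of_closed (X := Xᶜ) (fun c hc => (not_congr (key c hc)).1) ht
      tauto
  · intro h
    set T : Set G.edgeSet := (↑S \ {d.1}) ∪ Set.Iio d.1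
    obtain ⟨C, hC, hdC, hCX⟩ := exists_isCut_of_separated (R := R) (d := d)
      (X := {v | Reach R (dirEdges T) (R.tgt d) v}) (fun h' => h (h'.2 Reach.refl))
    have key : ∀ e ∈ C, e ∉ T := fun e he heT =>
      hCX (e, true) he (mem_reachable_iff (c := (e, true)) heT)
    refine ⟨C, hC, Finset.disjoint_left.2 fun e he heS => key e he (Or.inl (by simpa using heS)),
      hdC, fun e he => not_lt.1 fun hlt => key e he (Or.inr hlt)⟩

theorem mem_genCycleAct_iff (R : G.RefOrientation) (S : Finset G.edgeSet) (d : G.DirEdge) :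
    d.1 ∈ G.genCycleAct S ↔
      Reach R (dirEdges ((↑S \ {d.1}) \ Set.Iio d.1)) (R.tgt d) (R.src d) := by
  simp only [genCycleAct, Finset.mem_filter, Finset.mem_univ, true_and]
  set T : Set G.edgeSet := (↑S \ {d.1}) \ Set.Iio d.1
  constructor
  · rintro ⟨C, hC, hCS, hmin⟩
    by_contra h
    -- All edges of `C` except `d` are in `T`, so a cut at the boundary of a component of `T` would
    -- meet the cycle in `d` only.
    obtain ⟨K, hK, hdK, hKX⟩ := exists_isCut_of_separated (R := R) (d := d)
      (X := {v | Reach R (dirEdges T) (R.tgt d) v}) (fun h' => h (h'.2 Reach.refl))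
    refine hC.prop.2 K hK (Finset.card_eq_one.2 ⟨d.1, ?_⟩)
    ext e
    rw [Finset.mem_inter, Finset.mem_singleton]
    constructor
    · rintro ⟨heK, heC⟩
      by_contra hne
      refine hKX (e, true) heK (mem_reachable_iff (c := (e, true)) ⟨⟨?_, hne⟩, ?_⟩)
      · rcases (@Finset.mem_union _ (_) _ _ _).1 (hCS heC) with h | h
        · exact h
        · exact absurd (Finset.mem_singleton.1 h) hne
      · exact not_lt.2 (hmin.2 heC)
    · rintro rfl
      exact ⟨hdK, hmin.1⟩
  · intro h
    obtain ⟨D, hD, hdD, hDT⟩ := exists_isDirectedCycle h (fun h => h.1.2 rfl)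
    refine ⟨edges D, hD.1, edges_subset_iff.2 fun c hc => ?_, mem_edges_of_mem hdD, fun e he => ?_⟩
    · rcases hDT hc with rfl | h
      · simp
      · exact (@Finset.mem_union _ (_) _ _ _).2 (Or.inl h.1.1)
    · obtain ⟨c, hc, rfl⟩ := exists_mem_of_mem_edges (Finset.mem_coe.1 he)
      rcases hDT hc with rfl | h
      · exact le_rfl
      · exact not_lt.1 h.2

lemma disjoint_genCutAct_genCycleAct (R : G.RefOrientation) (S : Finset G.edgeSet) :
    Disjoint (G.genCutAct S) (G.genCycleAct S) := by
  refine Finset.disjoint_left.2 fun e h1 h2 => ?_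
  refine (mem_genCutAct_iff R S (e, true)).1 h1 (((mem_genCycleAct_iff R S (e, true)).1 h2).mono ?_)
  exact dirEdges_mono fun f hf => Or.inl hf.1

/-- For `f > e` both criteria ignore whether `e` is in `S`. For `f < e`, either `e` is a bridge over
a set that contains `f`, or its ends are already connected by larger edges of `S`; in both cases `e`
does not help to connect the ends of `f`. -/
lemma genAct_insert (R : G.RefOrientation) {S : Finset G.edgeSet} {e : G.edgeSet}
    (he : e ∈ G.genCutAct S ∪ G.genCycleAct S) :
    G.genCutAct (insert e S) = G.genCutAct S ∧ G.genCycleAct (insert e S) = G.genCycleAct S := by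
  by_cases heS : e ∈ S
  · simp [heS]
  suffices h : ∀ f, (f ∈ G.genCutAct (insert e S) ↔ f ∈ G.genCutAct S) ∧
      (f ∈ G.genCycleAct (insert e S) ↔ f ∈ G.genCycleAct S) from
    ⟨Finset.ext fun f => (h f).1, Finset.ext fun f => (h f).2⟩
  intro f
  have hcut := fun S => mem_genCutAct_iff R S (f, true)
  have hcyc := fun S => mem_genCycleAct_iff R S (f, true)
  simp only at hcut hcyc
  rw [hcut, hcut, hcyc, hcyc, Finset.coe_insert]
  rcases lt_trichotomy f e with hfe | rfl | hfe
  · have h1 : insert e (S : Set G.edgeSet) \ {f} ∪ Set.Iio f =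
        insert e (↑S \ {f} ∪ Set.Iio f) := by
      rw [Set.insert_sdiff_of_notMem _ (by simpa using hfe.ne'), Set.insert_union]
    have h2 : (insert e (S : Set G.edgeSet) \ {f}) \ Set.Iio f =
        insert e ((↑S \ {f}) \ Set.Iio f) := by
      rw [Set.insert_sdiff_of_notMem _ (by simpa using hfe.ne'),
        Set.insert_sdiff_of_notMem _ (by simpa using hfe.le)]
    rw [h1, h2]
    rcases Finset.mem_union.1 he with he | he
    · have he := (mem_genCutAct_iff R S (e, true)).1 he
      have hT : (S : Set G.edgeSet) \ {f} ∪ Set.Iio f ⊆ (↑S \ {e}) ∪ Set.Iio e := by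
        rintro g (hg | hg)
        · exact Or.inl ⟨hg.1, by rintro rfl; exact heS hg.1⟩
        · exact Or.inr (lt_trans hg hfe)
      exact ⟨not_congr (reach_dirEdges_insert_of_not_reach (d := (e, true)) he hT (Or.inr hfe)),
        reach_dirEdges_insert_of_not_reach (d := (e, true)) he
          (fun g hg => hT (Or.inl hg.1)) (Or.inr hfe)⟩
    · have he := (mem_genCycleAct_iff R S (e, true)).1 he
      have hT : ((S : Set G.edgeSet) \ {e}) \ Set.Iio e ⊆ (↑S \ {f}) \ Set.Iio f := by
        rintro g ⟨⟨hgS, -⟩, hg⟩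
        have hg : e ≤ g := not_lt.1 hg
        exact ⟨⟨hgS, (hfe.trans_le hg).ne'⟩, not_lt.2 (hfe.le.trans hg)⟩
      exact ⟨not_congr (reach_dirEdges_insert_of_reach (d := (e, true))
          (he.mono (dirEdges_mono (hT.trans fun g hg => Or.inl hg.1)))),
        reach_dirEdges_insert_of_reach (d := (e, true)) (he.mono (dirEdges_mono hT))⟩
  · have h : insert f (S : Set G.edgeSet) \ {f} = ↑S \ {f} := by simp
    rw [h]
    exact ⟨Iff.rfl, Iff.rfl⟩
  · have h1 : insert e (S : Set G.edgeSet) \ {f} ∪ Set.Iio f = ↑S \ {f} ∪ Set.Iio f := by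
      rw [Set.insert_sdiff_of_notMem _ (by simpa using hfe.ne), Set.insert_union]
      exact Set.insert_eq_of_mem (Or.inr hfe)
    have h2 : (insert e (S : Set G.edgeSet) \ {f}) \ Set.Iio f = (↑S \ {f}) \ Set.Iio f := by
      rw [Set.insert_sdiff_of_notMem _ (by simpa using hfe.ne),
        Set.insert_sdiff_of_mem _ (Set.mem_Iio.2 hfe)]
    rw [h1, h2]
    exact ⟨Iff.rfl, Iff.rfl⟩

lemma mem_genAct_erase_iff (R : G.RefOrientation) (S : Finset G.edgeSet) (e : G.edgeSet) :
    e ∈ G.genCutAct (S.erase e) ∪ G.genCycleAct (S.erase e) ↔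
      e ∈ G.genCutAct S ∪ G.genCycleAct S := by
  have h : ((S.erase e : Finset G.edgeSet) : Set G.edgeSet) \ {e} = ↑S \ {e} := by simp
  have hcut := fun S => mem_genCutAct_iff R S (e, true)
  have hcyc := fun S => mem_genCycleAct_iff R S (e, true)
  simp only at hcut hcyc
  rw [Finset.mem_union, Finset.mem_union, hcut, hcut, hcyc, hcyc, h]

lemma genAct_erase (R : G.RefOrientation) {S : Finset G.edgeSet} {e : G.edgeSet}
    (he : e ∈ G.genCutAct S ∪ G.genCycleAct S) :
    G.genCutAct (S.erase e) = G.genCutAct S ∧ G.genCycleAct (S.erase e) = G.genCycleAct S := by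
  by_cases heS : e ∈ S
  · have h := genAct_insert R ((mem_genAct_erase_iff R S e).2 he)
    rw [Finset.insert_erase heS] at h
    exact ⟨h.1.symm, h.2.symm⟩
  · rw [Finset.erase_eq_of_notMem heS]
    exact ⟨rfl, rfl⟩

lemma genAct_union (R : G.RefOrientation) {S T : Finset G.edgeSet}
    (hT : T ⊆ G.genCutAct S ∪ G.genCycleAct S) :
    G.genCutAct (S ∪ T) = G.genCutAct S ∧ G.genCycleAct (S ∪ T) = G.genCycleAct S := by
  induction T using Finset.induction_on with
  | empty => simp
  | insert e T _ ih =>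
    obtain ⟨h1, h2⟩ := ih ((Finset.subset_insert _ _).trans hT)
    have h := genAct_insert R (S := S ∪ T) (e := e)
      (by rw [h1, h2]; exact hT (Finset.mem_insert_self _ _))
    rwa [h1, h2, ← Finset.union_insert] at h

lemma genAct_sdiff (R : G.RefOrientation) {S T : Finset G.edgeSet}
    (hT : T ⊆ G.genCutAct S ∪ G.genCycleAct S) :
    G.genCutAct (S \ T) = G.genCutAct S ∧ G.genCycleAct (S \ T) = G.genCycleAct S := by
  induction T using Finset.induction_on with
  | empty => simp
  | insert e T _ ih =>
    obtain ⟨h1, h2⟩ := ih ((Finset.subset_insert _ _).trans hT)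
    have h := genAct_erase R (S := S \ T) (e := e)
      (by rw [h1, h2]; exact hT (Finset.mem_insert_self _ _))
    rwa [h1, h2, ← Finset.sdiff_insert] at h

/-! ### Counting active edges -/

/-- As in Kruskal's algorithm, the edges are added to `S` in increasing order. A new edge joins two
components exactly if it is cut active, since at that moment all smaller edges are present. -/
lemma numComponents_eq_add_card_of_isLowerSet (R : G.RefOrientation) (S T : Finset G.edgeSet)
    (hT : IsLowerSet (T : Set G.edgeSet)) :
    G.numComponents S = G.numComponents (S ∪ T) + ((G.genCutAct S \ S) ∩ T).card := by
  induction T using Finset.induction_on_max with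
  | empty => simp
  | insert a T hlt ih =>
    have ha : a ∉ T := fun h => lt_irrefl a (hlt a h)
    have hTa : ∀ b, b ∈ T ↔ b < a := by
      refine fun b => ⟨hlt b, fun hb => ?_⟩
      have := hT hb.le (Finset.mem_insert_self a T)
      exact (Finset.mem_insert.1 this).resolve_left hb.ne
    rw [ih fun b c hcb hb => (hTa c).2 (hcb.trans_lt (hlt b hb)), Finset.union_insert]
    by_cases haS : a ∈ S
    · rw [Finset.insert_eq_of_mem (Finset.mem_union_left _ haS),
        Finset.inter_insert_of_notMem (by simp [haS])]
    have hset : ((S ∪ T : Finset G.edgeSet) : Set G.edgeSet) = (↑S \ {a}) ∪ Set.Iio a := by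
      ext b
      simp only [Finset.coe_union, Set.mem_union, Finset.mem_coe, hTa, Set.mem_sdiff,
        Set.mem_singleton_iff, Set.mem_Iio]
      constructor
      · rintro (h | h)
        · exact Or.inl ⟨h, by rintro rfl; exact haS h⟩
        · exact Or.inr h
      · tauto
    have hmem := mem_genCutAct_iff R S (a, true)
    rw [← hset] at hmem
    by_cases hact : a ∈ G.genCutAct S
    · rw [Finset.inter_insert_of_mem (by simp [haS, hact]),
        Finset.card_insert_of_notMem (by simp [ha]),
        numComponents_insert_of_not_reach (S ∪ T) (a, true) (hmem.1 hact)]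
      ring
    · rw [Finset.inter_insert_of_notMem (by simp [hact]),
        numComponents_insert_of_reach (S ∪ T) (a, true) (not_not.1 fun h => hact (hmem.2 h))]

lemma numComponents_eq_add_card (R : G.RefOrientation) (S : Finset G.edgeSet) :
    G.numComponents S = G.numComponents Finset.univ + (G.genCutAct S \ S).card := by
  have h := numComponents_eq_add_card_of_isLowerSet R S Finset.univ (by simp [isLowerSet_univ])
  rwa [Finset.union_eq_right.2 (Finset.subset_univ S), Finset.inter_univ] at h

/-- Dually, `S` is built up from the empty graph in decreasing order, and an edge closes a cycle
exactly if it is cycle active. -/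
lemma card_add_numComponents_of_isUpperSet (R : G.RefOrientation) (S T : Finset G.edgeSet)
    (hT : IsUpperSet (T : Set G.edgeSet)) :
    (S ∩ T).card + G.numComponents (S ∩ T) =
      Fintype.card G.vertexSet + ((G.genCycleAct S ∩ S) ∩ T).card := by
  induction T using Finset.induction_on_min with
  | empty => simp [numComponents_empty]
  | insert a T hlt ih =>
    have ha : a ∉ T := fun h => lt_irrefl a (hlt a h)
    have hTa : ∀ b, b ∈ T ↔ a < b := by
      refine fun b => ⟨hlt b, fun hb => ?_⟩
      have := hT hb.le (Finset.mem_insert_self a T)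
      exact (Finset.mem_insert.1 this).resolve_left hb.ne'
    have ih := ih fun b c hcb hb => (hTa c).2 ((hlt b hb).trans_le hcb)
    by_cases haS : a ∈ S
    · have hset : ((S ∩ T : Finset G.edgeSet) : Set G.edgeSet) = (↑S \ {a}) \ Set.Iio a := by
        ext b
        simp only [Finset.coe_inter, Set.mem_inter_iff, Finset.mem_coe, hTa, Set.mem_sdiff,
          Set.mem_singleton_iff, Set.mem_Iio, not_lt, and_assoc, lt_iff_le_and_ne (a := a)]
        rw [and_comm (a := a ≤ b), ne_comm]
      have hmem := mem_genCycleAct_iff R S (a, true)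
      rw [← hset] at hmem
      rw [Finset.inter_insert_of_mem haS, Finset.card_insert_of_notMem (by simp [ha])]
      by_cases hact : a ∈ G.genCycleAct S
      · rw [Finset.inter_insert_of_mem (by simp [haS, hact]),
          Finset.card_insert_of_notMem (by simp [ha]),
          numComponents_insert_of_reach (S ∩ T) (a, true) (hmem.1 hact)]
        omega
      · rw [Finset.inter_insert_of_notMem (by simp [hact])]
        have := numComponents_insert_of_not_reach (S ∩ T) (a, true) (fun h => hact (hmem.2 h))
        simp only at this
        omega
    · rw [Finset.inter_insert_of_notMem haS, Finset.inter_insert_of_notMem (by simp [haS]), ih]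

lemma card_add_numComponents (R : G.RefOrientation) (S : Finset G.edgeSet) :
    S.card + G.numComponents S = Fintype.card G.vertexSet + (G.genCycleAct S ∩ S).card := by
  have h := card_add_numComponents_of_isUpperSet R S Finset.univ (by simp [isUpperSet_univ])
  simpa using h

/-! ### The Gordon–Traldi expansion -/

lemma sum_powerset_of_disjoint {ι K : Type*} [DecidableEq ι] [CommRing K] {I L : Finset ι}
    (h : Disjoint I L) (x w y z : K) :
    ∑ T ∈ (I ∪ L).powerset,
      x ^ (I ∩ T).card * w ^ (I \ T).card * y ^ (L \ T).card * z ^ (L ∩ T).card =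
        (x + w) ^ I.card * (y + z) ^ L.card := by
  have hI : ∏ i ∈ I, ((if i ∈ I then x else z) + if i ∈ I then w else y) = (x + w) ^ I.card := by
    rw [Finset.prod_congr rfl fun i hi => by rw [if_pos hi, if_pos hi], Finset.prod_const]
  have hL : ∏ i ∈ L, ((if i ∈ I then x else z) + if i ∈ I then w else y) = (y + z) ^ L.card := by
    rw [Finset.prod_congr rfl fun i hi => by
      rw [if_neg (Finset.disjoint_right.1 h hi), if_neg (Finset.disjoint_right.1 h hi), add_comm],
      Finset.prod_const]
  rw [← hI, ← hL, ← Finset.prod_union h, Finset.prod_add]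
  refine Finset.sum_congr rfl fun T hT => ?_
  rw [Finset.prod_ite, Finset.prod_ite]
  simp only [Finset.prod_const]
  have hT := Finset.mem_powerset.1 hT
  have h1 : T.filter (· ∈ I) = I ∩ T := by grind
  have h2 : T.filter (· ∉ I) = L ∩ T := by
    ext i
    have : i ∈ I → i ∉ L := fun hi => Finset.disjoint_left.1 h hi
    have := @hT i
    simp only [Finset.mem_filter, Finset.mem_inter, Finset.mem_union] at *
    tauto
  have h3 : ((I ∪ L) \ T).filter (· ∈ I) = I \ T := by grind
  have h4 : ((I ∪ L) \ T).filter (· ∉ I) = L \ T := by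
    ext i
    have : i ∈ I → i ∉ L := fun hi => Finset.disjoint_left.1 h hi
    simp only [Finset.mem_filter, Finset.mem_sdiff, Finset.mem_union] at *
    tauto
  rw [h1, h2, h3, h4]
  ring

/-- The Gordon–Traldi sum groups into intervals of spanning subgraphs with the same activities. -/
lemma gordonTraldiSum_eq (R : G.RefOrientation) {K : Type*} [CommRing K] (x w y z : K) :
    G.gordonTraldiSum x w y z =
      ∑ B : Finset G.edgeSet with Disjoint B (G.genCutAct B ∪ G.genCycleAct B),
        (x + w) ^ (G.genCutAct B).card * (y + z) ^ (G.genCycleAct B).card := by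
  rw [gordonTraldiSum]
  simp only [← sum_powerset_of_disjoint (disjoint_genCutAct_genCycleAct R _)]
  rw [Finset.sum_sigma']
  symm
  -- `S` is split into its inactive part `B` and its active part `T`. Activities agree on the whole
  -- interval from `B` to `B` plus its active edges, so `T` is an arbitrary set of active edges.
  have hact : ∀ S : Finset G.edgeSet,
      G.genCutAct (S \ (G.genCutAct S ∪ G.genCycleAct S)) = G.genCutAct S ∧
      G.genCycleAct (S \ (G.genCutAct S ∪ G.genCycleAct S)) = G.genCycleAct S :=
    fun S => genAct_sdiff R subset_rfl
  refine Finset.sum_bij' (fun p _ => p.1 ∪ p.2)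
    (fun S _ => ⟨S \ (G.genCutAct S ∪ G.genCycleAct S), S ∩ (G.genCutAct S ∪ G.genCycleAct S)⟩)
    (fun _ _ => Finset.mem_univ _) ?_ ?_ ?_ ?_
  · intro S _
    simp only [Finset.mem_sigma, Finset.mem_filter, Finset.mem_univ, true_and,
      Finset.mem_powerset, hact]
    exact ⟨Finset.sdiff_disjoint, Finset.inter_subset_right⟩
  · rintro ⟨B, T⟩ hBT
    simp only [Finset.mem_sigma, Finset.mem_filter, Finset.mem_univ, true_and,
      Finset.mem_powerset] at hBT
    obtain ⟨hB, hT⟩ := hBT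
    obtain ⟨h1, h2⟩ := genAct_union R hT
    simp only [h1, h2]
    rw [Finset.union_sdiff_distrib, Finset.sdiff_eq_self_of_disjoint hB,
      Finset.sdiff_eq_empty_iff_subset.2 hT, Finset.union_empty, Finset.union_inter_distrib_right,
      Finset.disjoint_iff_inter_eq_empty.1 hB, Finset.empty_union, Finset.inter_eq_left.2 hT]
  · intro S _
    exact Finset.sdiff_union_inter _ _
  · rintro ⟨B, T⟩ hBT
    simp only [Finset.mem_sigma, Finset.mem_filter, Finset.mem_univ, true_and,
      Finset.mem_powerset] at hBT
    obtain ⟨hB, hT⟩ := hBT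
    obtain ⟨h1, h2⟩ := genAct_union R hT
    have hB1 := Finset.disjoint_right.1 (Finset.disjoint_union_right.1 hB).1
    have hB2 := Finset.disjoint_right.1 (Finset.disjoint_union_right.1 hB).2
    simp only [h1, h2]
    have e1 : G.genCutAct B ∩ (B ∪ T) = G.genCutAct B ∩ T := by grind
    have e2 : G.genCutAct B \ (B ∪ T) = G.genCutAct B \ T := by grind
    have e3 : G.genCycleAct B \ (B ∪ T) = G.genCycleAct B \ T := by grind
    have e4 : G.genCycleAct B ∩ (B ∪ T) = G.genCycleAct B ∩ T := by grind
    rw [e1, e2, e3, e4]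

/-- Since only `x + w` and `y + z` matter, two variables may be set to `1`. What remains counts
inactive-to-`S` data: cut active edges outside `S` and cycle active edges inside, which are the
exponents in the Tutte polynomial. -/
theorem tutte_eq_gordonTraldiSum (R : G.RefOrientation) {K : Type*} [CommRing K] (x w y z : K) :
    G.tutte (x + w) (y + z) = G.gordonTraldiSum x w y z := by
  have h : G.gordonTraldiSum x w y z = G.gordonTraldiSum 1 (x + w - 1) 1 (y + z - 1) := by
    rw [gordonTraldiSum_eq R, gordonTraldiSum_eq R]
    simp only [add_sub_cancel]
  rw [h, tutte, gordonTraldiSum]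
  refine Finset.sum_congr rfl fun S _ => ?_
  have h1 := numComponents_eq_add_card R S
  have h2 := card_add_numComponents R S
  rw [h2, Nat.add_sub_cancel_left, h1, Nat.add_sub_cancel_left, one_pow, one_pow, one_mul, mul_one]

end Graph

namespace Graph

variable {α β : Type*} {G : Graph α β} {R : G.RefOrientation} [LinearOrder G.edgeSet]

/-! ### Removing the orientation of one edge -/

/-- `c` is the minimum of a potential cut of `O`, in terms of reachability. -/
def CutActive (R : G.RefOrientation) (O : Set G.DirEdge) (c : G.DirEdge) : Prop :=
  ¬ Reach R (O ∪ dirEdges (Set.Iio c.1)) (R.tgt c) (R.src c)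

/-- `c` is the minimum of a potential cycle of `O`, in terms of reachability. -/
def CycleActive (R : G.RefOrientation) (O : Set G.DirEdge) (c : G.DirEdge) : Prop :=
  c ∈ O ∧ Reach R ((O \ dirEdges (Set.Iio c.1)) \ {c.rev}) (R.tgt c) (R.src c)

/-- Adding `a` to `Q` destroys the cut activity of `c`. -/
def BlocksCut (R : G.RefOrientation) (Q : Set G.DirEdge) (a c : G.DirEdge) : Prop :=
  CutActive R Q c ∧ Reach R (Q ∪ dirEdges (Set.Iio c.1)) (R.tgt c) (R.src a) ∧
    Reach R (Q ∪ dirEdges (Set.Iio c.1)) (R.tgt a) (R.src c)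

/-- Adding `a` to `Q` creates the cycle activity of `c`. -/
def OpensCycle (R : G.RefOrientation) (Q : Set G.DirEdge) (a c : G.DirEdge) : Prop :=
  c.1 < a.1 ∧ c ∈ Q ∧ ¬ CycleActive R Q c ∧
    Reach R ((Q \ dirEdges (Set.Iio c.1)) \ {c.rev}) (R.tgt c) (R.src a) ∧
    Reach R ((Q \ dirEdges (Set.Iio c.1)) \ {c.rev}) (R.tgt a) (R.src c)

variable {Q : Set G.DirEdge} {a c c' : G.DirEdge}

lemma cutActive_insert_iff :
    CutActive R (insert a Q) c ↔ CutActive R Q c ∧ ¬ BlocksCut R Q a c := by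
  rw [BlocksCut, CutActive, CutActive, Set.insert_union, reach_insert_iff]
  tauto

/-- A return walk needs at most one of the two directions of `a`, so their effects do not interact.
-/
lemma cutActive_insert_insert_rev_iff :
    CutActive R (insert a (insert a.rev Q)) c ↔
      CutActive R Q c ∧ ¬ BlocksCut R Q a c ∧ ¬ BlocksCut R Q a.rev c := by
  rw [BlocksCut, BlocksCut, CutActive, CutActive, Set.insert_union, Set.insert_union,
    reach_insert_insert_rev_iff, R.src_rev, R.tgt_rev]
  tauto

lemma cycleActive_insert_of_lt (hac : a.1 < c.1) :
    CycleActive R (insert a Q) c ↔ CycleActive R Q c := by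
  have h : c ≠ a := by
    rintro rfl
    exact lt_irrefl _ hac
  rw [CycleActive, CycleActive, Set.insert_sdiff_of_mem _ (show a ∈ dirEdges (Set.Iio c.1) from hac),
    Set.mem_insert_iff, or_iff_right h]

lemma insert_sdiff_dirEdges_sdiff (hca : c.1 < a.1) :
    (insert a Q \ dirEdges (Set.Iio c.1)) \ {c.rev} =
      insert a ((Q \ dirEdges (Set.Iio c.1)) \ {c.rev}) := by
  rw [Set.insert_sdiff_of_notMem _ (show a ∉ dirEdges (Set.Iio c.1) from not_lt.2 hca.le),
    Set.insert_sdiff_of_notMem]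
  rintro rfl
  exact lt_irrefl _ hca

lemma cycleActive_insert_iff (hac : c.1 ≠ a.1) :
    CycleActive R (insert a Q) c ↔ CycleActive R Q c ∨ OpensCycle R Q a c := by
  rcases hac.lt_or_gt with h | h
  · have hne : c ≠ a := by
      rintro rfl
      exact lt_irrefl _ h
    rw [OpensCycle, CycleActive, CycleActive, insert_sdiff_dirEdges_sdiff h, reach_insert_iff,
      Set.mem_insert_iff, or_iff_right hne]
    tauto
  · rw [cycleActive_insert_of_lt h, OpensCycle]
    have := h.not_gt
    tauto

lemma cycleActive_insert_insert_rev_iff (hac : c.1 ≠ a.1) :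
    CycleActive R (insert a (insert a.rev Q)) c ↔
      CycleActive R Q c ∨ OpensCycle R Q a c ∨ OpensCycle R Q a.rev c := by
  rcases hac.lt_or_gt with h | h
  · have hne : c ≠ a := by
      rintro rfl
      exact lt_irrefl _ h
    have hne' : c ≠ a.rev := by
      rintro rfl
      exact lt_irrefl _ h
    rw [OpensCycle, OpensCycle, CycleActive, CycleActive, insert_sdiff_dirEdges_sdiff h,
      insert_sdiff_dirEdges_sdiff (a := a.rev) h, reach_insert_insert_rev_iff, R.src_rev,
      R.tgt_rev, Set.mem_insert_iff, or_iff_right hne, Set.mem_insert_iff, or_iff_right hne',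
      DirEdge.rev_fst]
    tauto
  · rw [cycleActive_insert_of_lt h, cycleActive_insert_of_lt (a := a.rev) h, OpensCycle, OpensCycle,
      DirEdge.rev_fst]
    have := h.not_gt
    tauto

/-- The walks that lead `c` through `a` and `c'` through `a.rev` can be cut open at `a` and joined
crosswise. With `c`, which is smaller than `c'` and hence freely usable, they form a return walk for
`c'` without `a`. -/
lemma BlocksCut.not_blocksCut_rev (h : BlocksCut R Q a c) (hc : c.1 < c'.1 ∨ c = c') :
    ¬ BlocksCut R Q a.rev c' := by
  rintro ⟨h', h1', h2'⟩
  obtain ⟨h, h1, h2⟩ := h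
  rw [R.src_rev] at h1'
  rw [R.tgt_rev] at h2'
  rcases hc with hc | rfl
  · have hsub : Q ∪ dirEdges (Set.Iio c.1) ⊆ Q ∪ dirEdges (Set.Iio c'.1) :=
      Set.union_subset_union_right _ (dirEdges_mono (Set.Iio_subset_Iio hc.le))
    have hcc : Reach R (Q ∪ dirEdges (Set.Iio c'.1)) (R.src c) (R.tgt c) :=
      Reach.of_mem (Or.inr hc)
    exact h' (h1'.trans ((h2.mono hsub).trans (hcc.trans ((h1.mono hsub).trans h2'))))
  · exact h (h1.trans h2')

/-- The same splicing: now `c'` is in `Q` and larger than `c`, so it may be used in a return walk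
for `c`, which makes `c` active already in `Q`. -/
lemma OpensCycle.not_opensCycle_rev (h : OpensCycle R Q a c) (hc : c.1 < c'.1 ∨ c = c') :
    ¬ OpensCycle R Q a.rev c' := by
  rintro ⟨-, hc', h', h1', h2'⟩
  obtain ⟨-, hcQ, h, h1, h2⟩ := h
  rw [R.src_rev] at h1'
  rw [R.tgt_rev] at h2'
  refine h ⟨hcQ, ?_⟩
  rcases hc with hc | rfl
  · have hsub : (Q \ dirEdges (Set.Iio c'.1)) \ {c'.rev} ⊆
        (Q \ dirEdges (Set.Iio c.1)) \ {c.rev} := by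
      rintro d ⟨⟨hd, hd'⟩, -⟩
      have hd' : c'.1 ≤ d.1 := not_lt.1 hd'
      refine ⟨⟨hd, not_lt.2 (hc.le.trans hd')⟩, ?_⟩
      rintro rfl
      exact absurd hc (not_lt.2 hd')
    have hcc : Reach R ((Q \ dirEdges (Set.Iio c.1)) \ {c.rev}) (R.src c') (R.tgt c') := by
      refine Reach.of_mem ⟨⟨hc', not_lt.2 hc.le⟩, ?_⟩
      rintro rfl
      exact lt_irrefl _ hc
    exact h1.trans ((h2'.mono hsub).trans (hcc.trans ((h1'.mono hsub).trans h2)))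
  · exact h1.trans h2'

lemma BlocksCut.not_opensCycle_rev (h : BlocksCut R Q a c) : ¬ OpensCycle R Q a.rev c' := by
  rintro ⟨-, hc', -, h1', h2'⟩
  obtain ⟨h, h1, h2⟩ := h
  rw [R.src_rev] at h1'
  rw [R.tgt_rev] at h2'
  have hsub : (Q \ dirEdges (Set.Iio c'.1)) \ {c'.rev} ⊆ Q ∪ dirEdges (Set.Iio c.1) :=
    fun d hd => Or.inl hd.1.1
  have hcc : Reach R (Q ∪ dirEdges (Set.Iio c.1)) (R.src c') (R.tgt c') :=
    Reach.of_mem (Or.inl hc')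
  exact h (h1.trans ((h2'.mono hsub).trans (hcc.trans ((h1'.mono hsub).trans h2))))

/-- No activity of the edges other than `a`, in the directions `δ`, is affected if `a` is added
to `Q`. -/
def IsNeutral (R : G.RefOrientation) (δ : G.edgeSet → Bool) (Q : Set G.DirEdge) (a : G.DirEdge) :
    Prop :=
  ∀ f, f ≠ a.1 → ¬ BlocksCut R Q a (f, δ f) ∧ ¬ OpensCycle R Q a (f, δ f)

lemma isNeutral_or_isNeutral_rev (δ : G.edgeSet → Bool) (Q : Set G.DirEdge) (a : G.DirEdge) :
    IsNeutral R δ Q a ∨ IsNeutral R δ Q a.rev := by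
  by_contra! h
  simp only [IsNeutral, DirEdge.rev_fst] at h
  push Not at h
  obtain ⟨⟨f, -, hf⟩, ⟨g, -, hg⟩⟩ := h
  have hf : BlocksCut R Q a (f, δ f) ∨ OpensCycle R Q a (f, δ f) := by tauto
  have hg : BlocksCut R Q a.rev (g, δ g) ∨ OpensCycle R Q a.rev (g, δ g) := by tauto
  -- In the two mixed cases the order of `f` and `g` is irrelevant; otherwise the splicing starts
  -- from the smaller one.
  rcases hf with hf | hf <;> rcases hg with hg | hg
  · rcases lt_trichotomy f g with hfg | rfl | hfg
    · exact hf.not_blocksCut_rev (Or.inl hfg) hg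
    · exact hf.not_blocksCut_rev (Or.inr rfl) hg
    · exact hg.not_blocksCut_rev (Or.inl hfg) (by rwa [DirEdge.rev_rev])
  · exact hf.not_opensCycle_rev hg
  · exact hg.not_opensCycle_rev (by rwa [DirEdge.rev_rev])
  · rcases lt_trichotomy f g with hfg | rfl | hfg
    · exact hf.not_opensCycle_rev (Or.inl hfg) hg
    · exact hf.not_opensCycle_rev (Or.inr rfl) hg
    · exact hg.not_opensCycle_rev (Or.inl hfg) (by rwa [DirEdge.rev_rev])

lemma not_blocksCut_of_lt (h : a.1 < c.1) : ¬ BlocksCut R Q a c := by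
  rintro ⟨h', h1, h2⟩
  exact h' (h1.trans ((Reach.of_mem (Or.inr h)).trans h2))

/-- Any effect of `a` on another edge `c` provides walks from the end of `a` to `c` and from `c` to
the beginning of `a`, and `c` itself may be used to join them. -/
lemma isNeutral_of_not_reach {δ : G.edgeSet → Bool}
    (h : ¬ Reach R (Q ∪ dirEdges (Set.Iio a.1)) (R.tgt a) (R.src a)) : IsNeutral R δ Q a := by
  intro f hf
  constructor
  · rcases hf.lt_or_gt with hf | hf
    · rintro ⟨-, h1, h2⟩
      have hsub : Q ∪ dirEdges (Set.Iio f) ⊆ Q ∪ dirEdges (Set.Iio a.1) :=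
        Set.union_subset_union_right _ (dirEdges_mono (Set.Iio_subset_Iio hf.le))
      exact h ((h2.mono hsub).trans ((Reach.of_mem (Or.inr hf)).trans (h1.mono hsub)))
    · exact not_blocksCut_of_lt hf
  · rintro ⟨-, hc, -, h1, h2⟩
    have hsub : (Q \ dirEdges (Set.Iio f)) \ {DirEdge.rev (f, δ f)} ⊆
        Q ∪ dirEdges (Set.Iio a.1) := fun d hd => Or.inl hd.1.1
    exact h ((h2.mono hsub).trans ((Reach.of_mem (Or.inl hc)).trans (h1.mono hsub)))

/-- Here `a` is redundant: a walk through it can be rerouted along edges of `Q` that are not smaller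
than `a`. -/
lemma isNeutral_of_reach {δ : G.edgeSet → Bool}
    (h : Reach R (Q \ dirEdges (Set.Iio a.1)) (R.src a) (R.tgt a)) : IsNeutral R δ Q a := by
  intro f hf
  constructor
  · rintro ⟨h', h1, h2⟩
    have hsub : Q \ dirEdges (Set.Iio a.1) ⊆ Q ∪ dirEdges (Set.Iio f) := fun d hd => Or.inl hd.1
    exact h' (h1.trans ((h.mono hsub).trans h2))
  · rintro ⟨hlt, hc, h', h1, h2⟩
    have hsub : Q \ dirEdges (Set.Iio a.1) ⊆
        (Q \ dirEdges (Set.Iio f)) \ {DirEdge.rev (f, δ f)} := by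
      rintro d ⟨hd, hd'⟩
      have hd' : a.1 ≤ d.1 := not_lt.1 hd'
      refine ⟨⟨hd, not_lt.2 (hlt.le.trans hd')⟩, ?_⟩
      rintro rfl
      exact absurd hlt (not_lt.2 hd')
    exact h' ⟨hc, h1.trans ((h.mono hsub).trans h2)⟩

/-- The two directions of an edge can be matched with its deletion and its contraction. -/
theorem exists_sign_isNeutral (R : G.RefOrientation) (δ : G.edgeSet → Bool) {Q : Set G.DirEdge}
    {e : G.edgeSet} (hQ : ∀ d ∈ Q, e < d.1 → d.rev ∈ Q) (he : ∀ d ∈ Q, d.1 ≠ e) :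
    ∃ s : Bool, IsNeutral R δ Q (e, s) ∧ (CutActive R Q (e, true) → s = false) ∧
      (Reach R (Q \ dirEdges (Set.Iio e)) (R.tgt (e, true)) (R.src (e, true)) → s = true) := by
  -- Since no edge above `e` is simply oriented, both reachability relations at `e` are symmetric.
  -- So an active `e` is neutral in both directions and its sign can be prescribed.
  have hsymm : ∀ d ∈ Q \ dirEdges (Set.Iio e), d.rev ∈ Q \ dirEdges (Set.Iio e) :=
    fun d hd => ⟨hQ d hd.1 (lt_of_le_of_ne (not_lt.1 hd.2) (he d hd.1).symm), hd.2⟩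
  have hsymm' : ∀ d ∈ Q ∪ dirEdges (Set.Iio e), d.rev ∈ Q ∪ dirEdges (Set.Iio e) := by
    intro d hd
    by_cases hlt : d.1 < e
    · exact Or.inr hlt
    · exact Or.inl (hsymm d ⟨hd.resolve_right hlt, hlt⟩).1
  by_cases hcut : CutActive R Q (e, true)
  · refine ⟨false, isNeutral_of_not_reach fun h => hcut (h.symm hsymm'), fun _ => rfl, fun h => ?_⟩
    exact absurd (h.mono fun d hd => Or.inl hd.1) hcut
  by_cases hcyc : Reach R (Q \ dirEdges (Set.Iio e)) (R.tgt (e, true)) (R.src (e, true))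
  · exact ⟨true, isNeutral_of_reach (hcyc.symm hsymm), fun h => absurd h hcut, fun _ => rfl⟩
  · rcases isNeutral_or_isNeutral_rev (R := R) δ Q (e, true) with h | h
    · exact ⟨true, h, fun h => absurd h hcut, fun h => absurd h hcyc⟩
    · exact ⟨false, h, fun h => absurd h hcut, fun h => absurd h hcyc⟩

/-- If `a` has no effect, then `a.rev` alone has the same effect as both directions together. -/
lemma IsNeutral.cutActive_insert_iff {δ : G.edgeSet → Bool} (h : IsNeutral R δ Q a)
    {f : G.edgeSet} (hf : f ≠ a.1) :
    (CutActive R (insert a Q) (f, δ f) ↔ CutActive R Q (f, δ f)) ∧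
      (CutActive R (insert a.rev Q) (f, δ f) ↔
        CutActive R (insert a (insert a.rev Q)) (f, δ f)) := by
  rw [Graph.cutActive_insert_iff, Graph.cutActive_insert_iff, cutActive_insert_insert_rev_iff]
  have := (h f hf).1
  tauto

lemma IsNeutral.cycleActive_insert_iff {δ : G.edgeSet → Bool} (h : IsNeutral R δ Q a)
    {f : G.edgeSet} (hf : f ≠ a.1) :
    (CycleActive R (insert a Q) (f, δ f) ↔ CycleActive R Q (f, δ f)) ∧
      (CycleActive R (insert a.rev Q) (f, δ f) ↔
        CycleActive R (insert a (insert a.rev Q)) (f, δ f)) := by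
  rw [Graph.cycleActive_insert_iff (c := (f, δ f)) hf,
    Graph.cycleActive_insert_iff (a := a.rev) (c := (f, δ f)) hf,
    cycleActive_insert_insert_rev_iff (c := (f, δ f)) hf]
  have := (h f hf).2
  tauto

end Graph

namespace Graph

variable {α β : Type*} {G : Graph α β}

/-! ### The map from fourientations to spanning subgraphs -/

namespace Fourientation

variable {O O' : G.Fourientation} {e f : G.edgeSet}

lemma ext_mem (h : ∀ e b, (e, b) ∈ O ↔ (e, b) ∈ O') : O = O' :=
  Finset.ext fun d => h d.1 d.2

variable [LinearOrder G.edgeSet]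

/-- The direction of `e` in `O`, or the one that the sign labels prescribe if `e` is not simply
oriented. -/
def dir (σu σb : G.edgeSet → Bool) (O : G.Fourientation) (e : G.edgeSet) : Bool :=
  -- For a bioriented edge the label names the direction that is removed, so the opposite one is
  -- kept.
  if (e, true) ∈ O then (if (e, false) ∈ O then !σb e else true)
  else (if (e, false) ∈ O then false else σu e)

lemma dir_congr {σu σb : G.edgeSet → Bool} (h : ∀ b, (e, b) ∈ O ↔ (e, b) ∈ O') :
    O.dir σu σb e = O'.dir σu σb e := by
  simp only [dir, h]

/-- The fourientation `O` with `e` made unoriented. -/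
def delete (O : G.Fourientation) (e : G.edgeSet) : G.Fourientation := O.filter fun d => d.1 ≠ e

@[simp] lemma mem_delete {d : G.DirEdge} : d ∈ O.delete e ↔ d ∈ O ∧ d.1 ≠ e := by simp [delete]

variable (R : G.RefOrientation) (σu σb : G.edgeSet → Bool)

/-- The direction of `e` that is to be replaced by the deletion of `e`; the opposite direction is to
be replaced by the contraction. -/
noncomputable def delSign (Q : G.Fourientation) (e : G.edgeSet) : Bool :=
  -- A sign with these properties is guaranteed if `Q` does not contain `e` and no larger edge is
  -- simply oriented in `Q`. The value depends on `Q` only, not on the direction that `e` had.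
  Classical.epsilon fun s => IsNeutral R (Q.dir σu σb) Q (e, s) ∧
    (CutActive R Q (e, true) → s = false) ∧
    (Reach R (Q \ dirEdges (Set.Iio e)) (R.tgt (e, true)) (R.src (e, true)) → s = true)

/-- Replace the simply oriented edge `e` by an unoriented or bioriented one. -/
noncomputable def step (O : G.Fourientation) (e : G.edgeSet) : G.Fourientation :=
  if (e, delSign R σu σb (O.delete e) e) ∈ O then O.delete e
  else insert (e, true) (insert (e, false) (O.delete e))

variable {R σu σb}

lemma mem_step_of_ne (h : f ≠ e) (b : Bool) : (f, b) ∈ step R σu σb O e ↔ (f, b) ∈ O := by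
  rw [step]
  split_ifs <;> simp [h]

lemma mem_step_self (b : Bool) :
    (e, b) ∈ step R σu σb O e ↔ (e, delSign R σu σb (O.delete e) e) ∉ O := by
  rw [step]
  split_ifs with h
  · simp [h]
  · cases b <;> simp [h]

lemma coe_step_of_notMem (h : (e, delSign R σu σb (O.delete e) e) ∉ O) :
    (step R σu σb O e : Set G.DirEdge) = insert (e, delSign R σu σb (O.delete e) e)
      (insert (DirEdge.rev (e, delSign R σu σb (O.delete e) e)) ↑(O.delete e)) := by
  rw [step, if_neg h]
  generalize delSign R σu σb (O.delete e) e = s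
  cases s
  · simp [DirEdge.rev, Set.insert_comm]
  · simp [DirEdge.rev]

/-- A return walk from the end of `(f, b)` to its beginning gains nothing from `(f, b)` itself. -/
lemma cutActive_delete_iff {b : Bool} (hb : (f, !b) ∉ O) :
    CutActive R (O.delete f) (f, b) ↔ CutActive R O (f, b) := by
  rw [CutActive, CutActive, not_iff_not]
  refine ⟨fun h => h.mono (Set.union_subset_union_left _ fun d hd => (mem_delete.1 hd).1),
    fun h => ?_⟩
  rw [← reach_insert_return]
  refine h.mono ?_
  rintro ⟨g, c⟩ (hg | hg)
  · by_cases hgf : g = f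
    · subst hgf
      have : c = b := by
        by_contra hcb
        rw [Finset.mem_coe, show c = !b by cases b <;> cases c <;> simp_all] at hg
        exact hb hg
      exact Or.inl (by rw [this])
    · exact Or.inr (Or.inl (mem_delete.2 ⟨hg, hgf⟩))
  · exact Or.inr (Or.inr hg)

lemma reach_delete_iff_cycleActive {b : Bool} (hb : (f, b) ∈ O) :
    Reach R (O.delete f \ dirEdges (Set.Iio f)) (R.tgt (f, b)) (R.src (f, b)) ↔
      CycleActive R O (f, b) := by
  rw [CycleActive, and_iff_right (Finset.mem_coe.2 hb)]
  constructor
  · refine fun h => h.mono ?_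
    rintro d ⟨hd, hd'⟩
    obtain ⟨h1, h2⟩ := mem_delete.1 hd
    refine ⟨⟨h1, hd'⟩, ?_⟩
    rintro rfl
    exact h2 rfl
  · intro h
    rw [← reach_insert_return]
    refine h.mono ?_
    rintro d ⟨⟨hd, hd'⟩, hd2⟩
    by_cases hdf : d.1 = f
    · exact Or.inl ((DirEdge.eq_or_eq_rev (d := (f, b)) hdf).resolve_right hd2)
    · exact Or.inr ⟨mem_delete.2 ⟨hd, hdf⟩, hd'⟩

variable [Fintype G.edgeSet]

@[simp] lemma mem_unor : e ∈ O.unor ↔ (e, true) ∉ O ∧ (e, false) ∉ O := by simp [unor]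

@[simp] lemma mem_bior : e ∈ O.bior ↔ (e, true) ∈ O ∧ (e, false) ∈ O := by simp [bior]

@[simp] lemma mem_pos : e ∈ O.pos ↔ (e, true) ∈ O ∧ (e, false) ∉ O := by simp [pos]

@[simp] lemma mem_neg : e ∈ O.neg ↔ (e, true) ∉ O ∧ (e, false) ∈ O := by simp [neg]

@[simp] lemma mem_ori : e ∈ O.ori ↔ ¬ ((e, true) ∈ O ↔ (e, false) ∈ O) := by
  simp only [ori, Finset.mem_union, mem_pos, mem_neg]
  tauto

lemma mem_iff_of_notMem_ori (h : e ∉ O.ori) (b b' : Bool) : (e, b) ∈ O ↔ (e, b') ∈ O := by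
  rw [mem_ori, not_not] at h
  cases b <;> cases b' <;> tauto

lemma mem_iff_of_mem_ori (h : e ∈ O.ori) (b : Bool) : (e, b) ∈ O ↔ (e, !b) ∉ O := by
  rw [mem_ori] at h
  cases b <;> simp only [Bool.not_true, Bool.not_false] <;> tauto

variable (R σu σb) in
lemma delSign_spec (hmax : ∀ f ∈ O.ori, f ≤ e) :
    IsNeutral R ((O.delete e).dir σu σb) (O.delete e)
        (e, delSign R σu σb (O.delete e) e) ∧
      (CutActive R (O.delete e) (e, true) → delSign R σu σb (O.delete e) e = false) ∧
      (Reach R (O.delete e \ dirEdges (Set.Iio e)) (R.tgt (e, true)) (R.src (e, true)) →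
        delSign R σu σb (O.delete e) e = true) := by
  refine Classical.epsilon_spec (exists_sign_isNeutral R ((O.delete e).dir σu σb)
    (Q := (O.delete e : Finset G.DirEdge)) (e := e) ?_ ?_)
  · intro d hd hlt
    rw [Finset.mem_coe, mem_delete] at hd ⊢
    exact ⟨(mem_iff_of_notMem_ori (fun h => absurd hlt (not_lt.2 (hmax _ h))) d.2 (!d.2)).1 hd.1,
      hd.2⟩
  · intro d hd
    exact (mem_delete.1 hd).2

lemma notMem_ori_step : e ∉ (step R σu σb O e).ori := by
  rw [mem_ori, mem_step_self, mem_step_self]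
  tauto

lemma ori_step : (step R σu σb O e).ori = O.ori.erase e := by
  ext f
  rw [Finset.mem_erase]
  by_cases h : f = e
  · subst h
    simpa using notMem_ori_step
  · simp [mem_step_of_ne h, h]

variable (R σu σb) in
/-- The result of replacing all simply oriented edges, from the largest to the smallest. -/
noncomputable def resolve (O : G.Fourientation) : G.Fourientation :=
  if h : O.ori.Nonempty then resolve (step R σu σb O (O.ori.max' h)) else O
termination_by O.ori.card
decreasing_by
  rw [ori_step]
  exact Finset.card_erase_lt_of_mem (O.ori.max'_mem h)

lemma resolve_of_ori_eq_empty (h : O.ori = ∅) : resolve R σu σb O = O := by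
  rw [resolve, dif_neg (by simp [h])]

lemma resolve_eq_resolve_step (he : e ∈ O.ori) (hmax : ∀ f ∈ O.ori, f ≤ e) :
    resolve R σu σb O = resolve R σu σb (step R σu σb O e) := by
  have h : O.ori.max' ⟨e, he⟩ = e :=
    le_antisymm (Finset.max'_le _ _ _ hmax) (Finset.le_max' _ _ he)
  rw [resolve, dif_pos ⟨e, he⟩, h]

variable (R σu σb) in
lemma resolve_induction {P : G.Fourientation → Prop} (h0 : ∀ O : G.Fourientation, O.ori = ∅ → P O)
    (h1 : ∀ (O : G.Fourientation) (e : G.edgeSet), e ∈ O.ori → (∀ f ∈ O.ori, f ≤ e) →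
      P (step R σu σb O e) → P O) (O : G.Fourientation) : P O := by
  induction hn : O.ori.card using Nat.strong_induction_on generalizing O with
  | _ n ih =>
    rcases O.ori.eq_empty_or_nonempty with h | h
    · exact h0 O h
    · refine h1 O _ (O.ori.max'_mem h) (fun f hf => Finset.le_max' _ _ hf) (ih _ ?_ _ rfl)
      rw [ori_step, ← hn]
      exact Finset.card_erase_lt_of_mem (O.ori.max'_mem h)

lemma ori_resolve (O : G.Fourientation) : (resolve R σu σb O).ori = ∅ := by
  induction O using resolve_induction R σu σb with
  | h0 O h => rw [resolve_of_ori_eq_empty h, h]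
  | h1 O e he hmax ih => rw [resolve_eq_resolve_step he hmax, ih]

lemma mem_resolve_of_notMem_ori (h : f ∉ O.ori) (b : Bool) :
    (f, b) ∈ resolve R σu σb O ↔ (f, b) ∈ O := by
  induction O using resolve_induction R σu σb with
  | h0 O hO => rw [resolve_of_ori_eq_empty hO]
  | h1 O e he hmax ih =>
    have hne : f ≠ e := by
      rintro rfl
      exact h he
    rw [resolve_eq_resolve_step he hmax, ih (by rw [ori_step]; simp only [Finset.mem_erase]; tauto),
      mem_step_of_ne hne]

/-- Knowing `O.ori` fixes the order of the steps. Each step can be undone: its outcome tells whether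
`e` had the direction `delSign`, and that sign is computed from the other edges. -/
lemma eq_of_resolve_eq (hori : O.ori = O'.ori)
    (h : resolve R σu σb O = resolve R σu σb O') : O = O' := by
  induction O using resolve_induction R σu σb generalizing O' with
  | h0 O hO => rwa [resolve_of_ori_eq_empty hO, resolve_of_ori_eq_empty (hori ▸ hO)] at h
  | h1 O e he hmax ih =>
    rw [resolve_eq_resolve_step he hmax,
      resolve_eq_resolve_step (hori ▸ he) (fun f hf => hmax f (hori ▸ hf))] at h
    have hstep := ih (by rw [ori_step, ori_step, hori]) h
    have hne : ∀ f b, f ≠ e → ((f, b) ∈ O ↔ (f, b) ∈ O') := by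
      intro f b hf
      rw [← mem_step_of_ne (R := R) (σu := σu) (σb := σb) hf, hstep, mem_step_of_ne hf]
    have hdel : O.delete e = O'.delete e := by
      ext ⟨f, b⟩
      rw [mem_delete, mem_delete]
      exact and_congr_left fun hf => hne f b hf
    have hs := mem_step_self (R := R) (σu := σu) (σb := σb) (O := O) (e := e) true
    rw [hstep, mem_step_self, ← hdel, not_iff_not] at hs
    refine ext_mem fun f b => ?_
    by_cases hf : f = e
    · subst hf
      have h1 := mem_iff_of_mem_ori he b
      have h2 := mem_iff_of_mem_ori (hori ▸ he) b
      generalize delSign R σu σb (O.delete f) f = s at hs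
      cases s <;> cases b <;> simp only [Bool.not_true, Bool.not_false] at h1 h2 <;> tauto
    · exact hne f b hf

/-! ### Activities are preserved -/

lemma dir_mem (h : e ∉ O.unor) : (e, O.dir σu σb e) ∈ O := by
  rw [mem_unor] at h
  rw [dir]
  split_ifs with h1 h2 h2
  · cases σb e <;> simpa
  · exact h1
  · exact h2
  · tauto

lemma not_dir_notMem (h : e ∉ O.bior) : (e, !O.dir σu σb e) ∉ O := by
  rw [mem_bior] at h
  rw [dir]
  split_ifs with h1 h2 h2
  · tauto
  · exact h2
  · exact h1
  · cases σu e <;> simpa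

lemma coe_eq_insert_delete (he : e ∈ O.ori) {s : Bool} (hs : (e, s) ∈ O) :
    (O : Set G.DirEdge) = insert (e, s) ↑(O.delete e) := by
  have hs' := (mem_iff_of_mem_ori he s).1 hs
  ext ⟨f, b⟩
  simp only [Finset.mem_coe, Set.mem_insert_iff, mem_delete, Prod.mk.injEq]
  by_cases hf : f = e
  · subst hf
    cases s <;> cases b <;> simp_all
  · simp [hf]

/-- The neutral direction is replaced by the deletion and the other one by the contraction, neither
of which other activities can distinguish from the direction replaced. -/
lemma active_step_iff (he : e ∈ O.ori) (hmax : ∀ f ∈ O.ori, f ≤ e) (hf : f ≠ e) :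
    (CutActive R (step R σu σb O e) (f, O.dir σu σb f) ↔ CutActive R O (f, O.dir σu σb f)) ∧
      (CycleActive R (step R σu σb O e) (f, O.dir σu σb f) ↔
        CycleActive R O (f, O.dir σu σb f)) := by
  obtain ⟨hneu, -, -⟩ := delSign_spec R σu σb hmax
  have hcut := hneu.cutActive_insert_iff hf
  have hcyc := hneu.cycleActive_insert_iff hf
  have hdir : (O.delete e).dir σu σb f = O.dir σu σb f := dir_congr (by simp [hf])
  rw [hdir] at hcut hcyc
  by_cases hs : (e, delSign R σu σb (O.delete e) e) ∈ O
  · have hstep : step R σu σb O e = O.delete e := by rw [step, if_pos hs]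
    rw [hstep, coe_eq_insert_delete he hs]
    exact ⟨hcut.1.symm, hcyc.1.symm⟩
  · have hs' : DirEdge.rev (e, delSign R σu σb (O.delete e) e) ∈ O := by
      have := mem_iff_of_mem_ori he (delSign R σu σb (O.delete e) e)
      simp only [DirEdge.rev]
      tauto
    rw [coe_step_of_notMem hs, coe_eq_insert_delete he hs']
    exact ⟨hcut.2.symm, hcyc.2.symm⟩

variable (R σu σb) in
/-- The spanning subgraph associated with a fourientation. -/
noncomputable def subgraph (O : G.Fourientation) : Finset G.edgeSet := (resolve R σu σb O).bior

lemma mem_resolve_iff (b : Bool) : (f, b) ∈ resolve R σu σb O ↔ f ∈ subgraph R σu σb O := by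
  have h : f ∉ (resolve R σu σb O).ori := by simp [ori_resolve]
  rw [subgraph, mem_bior, mem_iff_of_notMem_ori h b true, mem_iff_of_notMem_ori h false true,
    and_self]

lemma mem_subgraph_of_notMem_ori (h : f ∉ O.ori) (b : Bool) :
    f ∈ subgraph R σu σb O ↔ (f, b) ∈ O := by
  rw [← mem_resolve_iff b, mem_resolve_of_notMem_ori h]

lemma subgraph_step (he : e ∈ O.ori) (hmax : ∀ f ∈ O.ori, f ≤ e) :
    subgraph R σu σb (step R σu σb O e) = subgraph R σu σb O := by
  rw [subgraph, subgraph, resolve_eq_resolve_step he hmax]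

lemma mem_subgraph_max (he : e ∈ O.ori) (hmax : ∀ f ∈ O.ori, f ≤ e) :
    e ∈ subgraph R σu σb O ↔ (e, delSign R σu σb (O.delete e) e) ∉ O := by
  rw [← subgraph_step he hmax, mem_subgraph_of_notMem_ori notMem_ori_step true, mem_step_self]

lemma injective_subgraph_ori :
    Function.Injective fun O : G.Fourientation => (subgraph R σu σb O, O.ori) := by
  intro O O' h
  simp only [Prod.mk.injEq] at h
  refine eq_of_resolve_eq (R := R) (σu := σu) (σb := σb) h.2 (ext_mem fun f b => ?_)
  rw [mem_resolve_iff, mem_resolve_iff, h.1]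

/-- If no edge larger than `f` is simply oriented, then `O` agrees with its subgraph there. -/
lemma dirEdges_subgraph_eq (hmax : ∀ g ∈ O.ori, g ≤ f) :
    dirEdges ((↑(subgraph R σu σb O) \ {f}) ∪ Set.Iio f) =
        (O.delete f : Set G.DirEdge) ∪ dirEdges (Set.Iio f) ∧
      dirEdges ((↑(subgraph R σu σb O) \ {f}) \ Set.Iio f) =
        (O.delete f : Set G.DirEdge) \ dirEdges (Set.Iio f) := by
  have key : ∀ g b, f < g → (g ∈ subgraph R σu σb O ↔ (g, b) ∈ O) := fun g b hg =>
    mem_subgraph_of_notMem_ori (fun h => absurd hg (not_lt.2 (hmax g h))) b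
  constructor
  all_goals
    ext ⟨g, b⟩
    have := key g b
    simp only [mem_dirEdges, Set.mem_union, Set.mem_sdiff, Finset.mem_coe, Set.mem_singleton_iff,
      Set.mem_Iio, mem_delete]
    rcases lt_trichotomy f g with h | rfl | h
    · have := h.ne'
      tauto
    · simp
    · simp [h]

variable [Fintype G.vertexSet]

theorem mem_genCutAct_subgraph_iff (hf : f ∉ O.bior) :
    f ∈ G.genCutAct (subgraph R σu σb O) ↔ CutActive R O (f, O.dir σu σb f) := by
  -- Once no edge above `f` is simply oriented, the directed and the undirected criterion at `f`
  -- coincide. Until then, `active_step_iff` carries the activity of `f` along.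
  have hmax : ∀ O : G.Fourientation, (∀ g ∈ O.ori, g ≤ f) → f ∉ O.bior →
      (f ∈ G.genCutAct (subgraph R σu σb O) ↔ CutActive R O (f, O.dir σu σb f)) := by
    intro O hmax hf
    have h := fun b => mem_genCutAct_iff R (subgraph R σu σb O) (f, b)
    simp only [(dirEdges_subgraph_eq hmax).1] at h
    rw [← cutActive_delete_iff (not_dir_notMem hf)]
    exact h _
  induction O using resolve_induction R σu σb with
  | h0 O hO => exact hmax O (by simp [hO]) hf
  | h1 O e he hle ih =>
    by_cases hfe : f = e
    · subst hfe
      exact hmax O hle hf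
    · have hdir : (step R σu σb O e).dir σu σb f = O.dir σu σb f := dir_congr (mem_step_of_ne hfe)
      have ih := ih (by simpa [mem_step_of_ne hfe] using hf)
      rw [subgraph_step he hle, hdir] at ih
      exact Iff.trans ih (active_step_iff he hle hfe).1

theorem mem_genCycleAct_subgraph_iff (hf : f ∉ O.unor) :
    f ∈ G.genCycleAct (subgraph R σu σb O) ↔ CycleActive R O (f, O.dir σu σb f) := by
  have hmax : ∀ O : G.Fourientation, (∀ g ∈ O.ori, g ≤ f) → f ∉ O.unor →
      (f ∈ G.genCycleAct (subgraph R σu σb O) ↔ CycleActive R O (f, O.dir σu σb f)) := by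
    intro O hmax hf
    have h := fun b => mem_genCycleAct_iff R (subgraph R σu σb O) (f, b)
    simp only [(dirEdges_subgraph_eq hmax).2] at h
    rw [← reach_delete_iff_cycleActive (dir_mem hf)]
    exact h _
  induction O using resolve_induction R σu σb with
  | h0 O hO => exact hmax O (by simp [hO]) hf
  | h1 O e he hle ih =>
    by_cases hfe : f = e
    · subst hfe
      exact hmax O hle hf
    · have hdir : (step R σu σb O e).dir σu σb f = O.dir σu σb f := dir_congr (mem_step_of_ne hfe)
      have ih := ih (by simpa [mem_step_of_ne hfe] using hf)
      rw [subgraph_step he hle, hdir] at ih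
      exact Iff.trans ih (active_step_iff he hle hfe).2

/-- The direction of a simply oriented active edge tells whether it is in the subgraph. -/
theorem mem_subgraph_of_active (hf : f ∈ O.ori) :
    (f ∈ G.genCutAct (subgraph R σu σb O) → (f ∈ subgraph R σu σb O ↔ (f, true) ∈ O)) ∧
      (f ∈ G.genCycleAct (subgraph R σu σb O) →
        (f ∈ subgraph R σu σb O ↔ (f, false) ∈ O)) := by
  induction O using resolve_induction R σu σb with
  | h0 O hO => simp [hO] at hf
  | h1 O e he hle ih =>
    by_cases hfe : f = e
    · subst hfe
      obtain ⟨-, h1, h2⟩ := delSign_spec R σu σb hle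
      have hmem := mem_iff_of_mem_ori hf
      rw [mem_subgraph_max he hle]
      constructor
      · intro h
        rw [h1 ?_, hmem true]
        · rfl
        have := (mem_genCutAct_iff R (subgraph R σu σb O) (f, true)).1 h
        rwa [(dirEdges_subgraph_eq hle).1] at this
      · intro h
        rw [h2 ?_, hmem false]
        · rfl
        have := (mem_genCycleAct_iff R (subgraph R σu σb O) (f, true)).1 h
        rwa [(dirEdges_subgraph_eq hle).2] at this
    · have ih := ih (by rw [ori_step]; exact Finset.mem_erase.2 ⟨hfe, hf⟩)
      rwa [subgraph_step he hle, mem_step_of_ne hfe, mem_step_of_ne hfe] at ih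

end Fourientation

end Graph

/-! ### Fibres of the map, and the special case of orientations -/

namespace Graph

variable {α β : Type*} {G : Graph α β} [Fintype G.edgeSet] [LinearOrder G.edgeSet]
  {R : G.RefOrientation} {σu σb : G.edgeSet → Bool}

namespace Fourientation

lemma mem_cutActOri {O : G.Fourientation} {e : G.edgeSet} :
    e ∈ O.cutActOri R ↔ e ∈ O.ori ∧ ∃ D, IsPotentialCut R O D ∧ IsMinEdge e D := by
  classical exact Finset.mem_filter

lemma mem_cycleActOri {O : G.Fourientation} {e : G.edgeSet} :
    e ∈ O.cycleActOri R ↔ e ∈ O.ori ∧ ∃ D, IsPotentialCycle R O D ∧ IsMinEdge e D := by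
  classical exact Finset.mem_filter

lemma mem_cutActUnor {O : G.Fourientation} {e : G.edgeSet} :
    e ∈ O.cutActUnor R σu ↔
      e ∈ O.unor ∧ ∃ D, IsPotentialCut R (O ∪ {(e, σu e)}) D ∧ IsMinEdge e D := by
  simp only [cutActUnor, Finset.mem_filter]
  congr!

lemma mem_cycleActBior {O : G.Fourientation} {e : G.edgeSet} :
    e ∈ O.cycleActBior R σb ↔
      e ∈ O.bior ∧ ∃ D, IsPotentialCycle R (O \ {(e, σb e)}) D ∧ IsMinEdge e D := by
  simp only [cycleActBior, Finset.mem_filter]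
  congr!

lemma mem_orientationCutAct {O : G.Fourientation} {e : G.edgeSet} :
    e ∈ O.orientationCutAct R ↔ ∃ D, IsDirectedCut R D ∧ D ⊆ O ∧ IsMinEdge e D := by
  simp [orientationCutAct]

lemma mem_orientationCycleAct {O : G.Fourientation} {e : G.edgeSet} :
    e ∈ O.orientationCycleAct R ↔ ∃ D, IsDirectedCycle R D ∧ D ⊆ O ∧ IsMinEdge e D := by
  simp [orientationCycleAct]

lemma IsOrientation.mem_ori {O : G.Fourientation} (hO : O.IsOrientation) (e : G.edgeSet) :
    e ∈ O.ori := by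
  have h := hO e
  rw [Fourientation.mem_ori]
  rw [xor_iff_not_iff] at h
  exact h

lemma isOrientation_iff {O : G.Fourientation} :
    O.IsOrientation ↔ O.unor = ∅ ∧ O.bior = ∅ := by
  simp only [IsOrientation, Finset.eq_empty_iff_forall_notMem, mem_unor, mem_bior,
    xor_iff_not_iff, ← forall_and]
  refine forall_congr' fun e => ?_
  tauto

lemma IsOrientation.rev_notMem_iff {O : G.Fourientation} (hO : O.IsOrientation) (d : G.DirEdge) :
    (d.1, !d.2) ∉ O ↔ d ∈ O :=
  (mem_iff_of_mem_ori (hO.mem_ori d.1) d.2).symm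

lemma IsOrientation.orientationCutAct_eq {O : G.Fourientation} (hO : O.IsOrientation) :
    O.orientationCutAct R = O.cutActOri R := by
  ext e
  rw [mem_orientationCutAct, mem_cutActOri, and_iff_right (hO.mem_ori e)]
  simp only [IsPotentialCut, hO.rev_notMem_iff, and_assoc]
  rfl

lemma IsOrientation.orientationCycleAct_eq {O : G.Fourientation} (hO : O.IsOrientation) :
    O.orientationCycleAct R = O.cycleActOri R := by
  ext e
  rw [mem_orientationCycleAct, mem_cycleActOri, and_iff_right (hO.mem_ori e)]
  simp only [IsPotentialCycle, and_assoc]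
  rfl

/-- Injectivity suffices, as both sides have `4 ^ |E|` elements. -/
lemma bijective_subgraph_ori (R : G.RefOrientation) (σu σb : G.edgeSet → Bool) :
    Function.Bijective fun O : G.Fourientation => (subgraph R σu σb O, O.ori) := by
  rw [Fintype.bijective_iff_injective_and_card]
  refine ⟨injective_subgraph_ori, ?_⟩
  rw [Fintype.card_finset, Fintype.card_prod, Fintype.card_prod, Fintype.card_finset,
    Fintype.card_bool, mul_two, pow_add]

lemma card_subgraph_eq (R : G.RefOrientation) (σu σb : G.edgeSet → Bool) (S : Finset G.edgeSet) :
    Nat.card {O : G.Fourientation // subgraph R σu σb O = S} = 2 ^ Fintype.card G.edgeSet := by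
  have hbij := bijective_subgraph_ori R σu σb
  have h : Function.Bijective
      (fun O : {O : G.Fourientation // subgraph R σu σb O = S} => O.1.ori) := by
    constructor
    · rintro ⟨O, hO⟩ ⟨O', hO'⟩ h
      exact Subtype.ext (hbij.1 (Prod.ext (hO.trans hO'.symm) h))
    · intro A
      obtain ⟨O, hO⟩ := hbij.2 (S, A)
      exact ⟨⟨O, congrArg Prod.fst hO⟩, congrArg Prod.snd hO⟩
  rw [Nat.card_eq_of_bijective _ h, Nat.card_eq_fintype_card, Fintype.card_finset]

lemma notMem_subgraph_of_mem_unor {O : G.Fourientation} {e : G.edgeSet} (h : e ∈ O.unor) :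
    e ∉ subgraph R σu σb O := by
  rw [mem_unor] at h
  rw [mem_subgraph_of_notMem_ori (b := true) (by rw [mem_ori]; tauto)]
  exact h.1

lemma mem_subgraph_of_mem_bior {O : G.Fourientation} {e : G.edgeSet} (h : e ∈ O.bior) :
    e ∈ subgraph R σu σb O := by
  rw [mem_bior] at h
  rw [mem_subgraph_of_notMem_ori (b := true) (by rw [mem_ori]; tauto)]
  exact h.1

lemma unor_bior_eq {O : G.Fourientation} {S : Finset G.edgeSet} (hu : ∀ e ∈ O.unor, e ∉ S)
    (hb : ∀ e ∈ O.bior, e ∈ S) : O.unor = Sᶜ \ O.ori ∧ O.bior = S \ O.ori := by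
  constructor
  all_goals
    ext e
    have h1 := hu e
    have h2 := hb e
    clear hu hb
    simp only [mem_unor, mem_bior, Finset.mem_sdiff, Finset.mem_compl, Fourientation.mem_ori] at *
    tauto

/-- For active edges the sign is encoded by membership in the subgraph. This makes the monomial of
`O` a function of the pair of `S` and `O.ori`. -/
lemma inter_pos_neg_eq {O : G.Fourientation} {S T : Finset G.edgeSet}
    (h : ∀ e ∈ T, e ∈ O.ori → (e ∈ S ↔ (e, true) ∈ O)) :
    T ∩ O.pos = T ∩ (O.ori ∩ S) ∧ T ∩ O.neg = T ∩ (O.ori \ S) := by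
  constructor
  all_goals
    ext e
    rw [Finset.mem_inter, Finset.mem_inter]
    refine and_congr_right fun he => ?_
    replace h := h e he
    simp only [mem_pos, mem_neg, Finset.mem_inter, Finset.mem_sdiff, Fourientation.mem_ori] at *
    tauto

lemma inter_pos_neg_eq' {O : G.Fourientation} {S T : Finset G.edgeSet}
    (h : ∀ e ∈ T, e ∈ O.ori → (e ∈ S ↔ (e, false) ∈ O)) :
    T ∩ O.pos = T ∩ (O.ori \ S) ∧ T ∩ O.neg = T ∩ (O.ori ∩ S) := by
  constructor
  all_goals
    ext e
    rw [Finset.mem_inter, Finset.mem_inter]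
    refine and_congr_right fun he => ?_
    replace h := h e he
    simp only [mem_pos, mem_neg, Finset.mem_inter, Finset.mem_sdiff, Fourientation.mem_ori] at *
    tauto

end Fourientation

/-- The factors `0 ^ O.unor.card` and `0 ^ O.bior.card` remove everything but the orientations,
where they are `0 ^ 0 = 1`. -/
lemma fourientationSum_eq_lasVergnasSum {I L φ : G.Fourientation → Finset G.edgeSet}
    (hI : ∀ O : G.Fourientation, I O ∩ O.ori = O.cutActOri R)
    (hL : ∀ O : G.Fourientation, L O ∩ O.ori = O.cycleActOri R) {K : Type*} [CommRing K]
    (x w x' w' y z y' z' : K) :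
    fourientationSum I L φ 1 1 0 0 x w x' w' y z y' z' = lasVergnasSum R x w y z := by
  classical
  rw [lasVergnasSum, fourientationSum, Finset.sum_filter]
  refine Finset.sum_congr rfl fun O _ => ?_
  split_ifs with hO
  · obtain ⟨hu, hb⟩ := Fourientation.isOrientation_iff.1 hO
    have hori : O.ori = Finset.univ := Finset.eq_univ_of_forall hO.mem_ori
    rw [hO.orientationCutAct_eq, hO.orientationCycleAct_eq, ← hI, ← hL, hu, hb, hori]
    simp
    congr!
  · rw [Fourientation.isOrientation_iff, not_and_or] at hO
    rcases hO with hO | hO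
    · rw [zero_pow (M₀ := K) (n := O.unor.card) (by simpa using hO)]
      simp
    · rw [zero_pow (M₀ := K) (n := O.bior.card) (by simpa using hO)]
      simp

/-! ### Activities in terms of potential cuts and cycles -/

variable [Fintype G.vertexSet]

/-- As `d` is in `O`, a potential cut cannot contain `d.rev`, so it uses its minimum edge in the
direction `d`. -/
lemma exists_potentialCut_min_iff {O : G.Fourientation} {d : G.DirEdge} (hd : d ∈ O) :
    (∃ D, IsPotentialCut R O D ∧ IsMinEdge d.1 D) ↔ CutActive R O d := by
  rw [CutActive, ← exists_potentialCut_iff]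
  constructor
  · rintro ⟨D, hD, hmin⟩
    refine ⟨D, hD, hmin, (mem_edges_iff.1 (Finset.mem_coe.1 hmin.1)).resolve_right fun h => ?_⟩
    have := hD.2 _ h
    change d.rev.rev ∉ O at this
    rw [DirEdge.rev_rev] at this
    exact this hd
  · rintro ⟨D, hD, hmin, -⟩
    exact ⟨D, hD, hmin⟩

lemma exists_potentialCycle_min_iff {O : G.Fourientation} {d : G.DirEdge} (hd : d.rev ∉ O) :
    (∃ D, IsPotentialCycle R O D ∧ IsMinEdge d.1 D) ↔ CycleActive R O d := by
  rw [CycleActive, Finset.mem_coe, ← exists_potentialCycle_iff]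
  constructor
  · rintro ⟨D, hD, hmin⟩
    refine ⟨D, hD, hmin, (mem_edges_iff.1 (Finset.mem_coe.1 hmin.1)).resolve_right fun h => ?_⟩
    exact hd (hD.2 _ h)
  · rintro ⟨D, hD, hmin, -⟩
    exact ⟨D, hD, hmin⟩

namespace Fourientation

lemma genCutAct_inter_ori (O : G.Fourientation) :
    G.genCutAct (subgraph R σu σb O) ∩ O.ori = O.cutActOri R := by
  ext e
  rw [mem_cutActOri, Finset.mem_inter, and_comm]
  refine and_congr_right fun he => ?_
  rw [mem_ori] at he
  rw [mem_genCutAct_subgraph_iff (by rw [mem_bior]; tauto)]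
  exact (exists_potentialCut_min_iff (dir_mem (by rw [mem_unor]; tauto))).symm

lemma genCutAct_inter_unor (O : G.Fourientation) :
    G.genCutAct (subgraph R σu σb O) ∩ O.unor = O.cutActUnor R σu := by
  ext e
  rw [mem_cutActUnor, Finset.mem_inter, and_comm]
  refine and_congr_right fun he => ?_
  rw [mem_unor] at he
  have hdir : O.dir σu σb e = σu e := by rw [dir, if_neg he.1, if_neg he.2]
  rw [mem_genCutAct_subgraph_iff (by rw [mem_bior]; tauto), hdir]
  have h := exists_potentialCut_min_iff (R := R) (O := O ∪ {(e, σu e)}) (d := (e, σu e)) (by simp)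
  refine Iff.trans ?_ h.symm
  -- The added direction only forces the cut to contain `e` in that direction; it does not affect
  -- the return walks.
  rw [CutActive, CutActive, Finset.coe_union, Finset.coe_singleton, Set.union_singleton,
    Set.insert_union, reach_insert_return]

lemma genCycleAct_inter_ori (O : G.Fourientation) :
    G.genCycleAct (subgraph R σu σb O) ∩ O.ori = O.cycleActOri R := by
  ext e
  rw [mem_cycleActOri, Finset.mem_inter, and_comm]
  refine and_congr_right fun he => ?_
  rw [mem_ori] at he
  rw [mem_genCycleAct_subgraph_iff (by rw [mem_unor]; tauto)]
  exact (exists_potentialCycle_min_iff (not_dir_notMem (by rw [mem_bior]; tauto))).symm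

lemma genCycleAct_inter_bior (O : G.Fourientation) :
    G.genCycleAct (subgraph R σu σb O) ∩ O.bior = O.cycleActBior R σb := by
  ext e
  rw [mem_cycleActBior, Finset.mem_inter, and_comm]
  refine and_congr_right fun he => ?_
  rw [mem_bior] at he
  have hdir : O.dir σu σb e = !σb e := by rw [dir, if_pos he.1, if_pos he.2]
  have hmem : ∀ b, (e, b) ∈ O := fun b => by cases b <;> tauto
  have hrev : DirEdge.rev (e, !σb e) = (e, σb e) := by simp [DirEdge.rev]
  rw [mem_genCycleAct_subgraph_iff (by rw [mem_unor]; tauto), hdir]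
  have h := exists_potentialCycle_min_iff (R := R) (O := O \ {(e, σb e)}) (d := (e, !σb e))
    (by simp [hrev])
  refine Iff.trans ?_ h.symm
  -- The direction removed from `O` is the one that the cycle criterion excludes anyway.
  have hset : ((O \ {(e, σb e)} : Set G.DirEdge) \ dirEdges (Set.Iio e)) \ {(e, σb e)} =
      ((O : Set G.DirEdge) \ dirEdges (Set.Iio e)) \ {(e, σb e)} := by
    ext d
    simp only [Set.mem_sdiff]
    tauto
  rw [CycleActive, CycleActive, hrev, Finset.coe_sdiff, Finset.coe_singleton, hset]
  simp [hmem]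

end Fourientation

/-! ### The twelve variable expansion -/

lemma pow_card_eq_prod_ite {ι K : Type*} [Fintype ι] [DecidableEq ι] [CommMonoid K] (T : Finset ι)
    (k : K) : k ^ T.card = ∏ i, if i ∈ T then k else 1 := by
  rw [Finset.prod_ite_mem, Finset.univ_inter, Finset.prod_const]

lemma sum_prod_ite_mem {ι K : Type*} [Fintype ι] [DecidableEq ι] [CommRing K] (f g : ι → K) :
    ∑ A : Finset ι, ∏ i, (if i ∈ A then f i else g i) = ∏ i, (f i + g i) := by
  rw [Finset.prod_add, Finset.powerset_univ]
  refine Finset.sum_congr rfl fun A _ => ?_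
  rw [Finset.prod_ite]
  congr 2 <;> (ext; simp)

lemma sum_activity_monomials {ι K : Type*} [Fintype ι] [DecidableEq ι] [CommRing K]
    {I L : Finset ι} (hIL : Disjoint I L) (S : Finset ι) (k₁ k₂ l m x w x' w' y z y' z' : K) :
    ∑ A : Finset ι, k₁ ^ (A ∩ S).card * k₂ ^ (A \ S).card * l ^ (Sᶜ \ A).card * m ^ (S \ A).card *
      x ^ (I ∩ (A ∩ S)).card * w ^ (I ∩ (A \ S)).card *
      x' ^ (I ∩ (S \ A)).card * w' ^ (I ∩ (Sᶜ \ A)).card *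
      y ^ (L ∩ (A \ S)).card * z ^ (L ∩ (A ∩ S)).card *
      y' ^ (L ∩ (Sᶜ \ A)).card * z' ^ (L ∩ (S \ A)).card =
    (k₁ * x + m * x') ^ (I ∩ S).card * (k₂ * w + l * w') ^ (I \ S).card *
      (k₂ * y + l * y') ^ (L \ S).card * (k₁ * z + m * z') ^ (L ∩ S).card *
      (k₁ + m) ^ (S \ (I ∪ L)).card * (k₂ + l) ^ (Sᶜ \ (I ∪ L)).card := by
  -- The sum is a product over the edges: `f i` is the weight of `i` if it is simply oriented, and
  -- `g i` its weight otherwise.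
  let f : ι → K := fun i =>
    if i ∈ S then k₁ * (if i ∈ I then x else 1) * (if i ∈ L then z else 1)
    else k₂ * (if i ∈ I then w else 1) * (if i ∈ L then y else 1)
  let g : ι → K := fun i =>
    if i ∈ S then m * (if i ∈ I then x' else 1) * (if i ∈ L then z' else 1)
    else l * (if i ∈ I then w' else 1) * (if i ∈ L then y' else 1)
  trans ∏ i, (f i + g i)
  · rw [← sum_prod_ite_mem]
    refine Finset.sum_congr rfl fun A _ => ?_
    simp only [pow_card_eq_prod_ite, ← Finset.prod_mul_distrib]
    refine Finset.prod_congr rfl fun i _ => ?_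
    by_cases hA : i ∈ A <;> by_cases hS : i ∈ S <;> simp [f, g, hA, hS]
  · simp only [pow_card_eq_prod_ite, ← Finset.prod_mul_distrib]
    refine Finset.prod_congr rfl fun i _ => ?_
    have hi : i ∈ I → i ∉ L := fun h => Finset.disjoint_left.1 hIL h
    by_cases hS : i ∈ S <;> by_cases hI : i ∈ I <;> by_cases hL : i ∈ L <;>
      first | exact absurd hL (hi hI) | simp [f, g, hS, hI, hL]

open Fourientation in
lemma fourientationSum_eq_sum_subgraph (R : G.RefOrientation) (σu σb : G.edgeSet → Bool)
    {K : Type*} [CommRing K] (k₁ k₂ l m x w x' w' y z y' z' : K) :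
    fourientationSum (fun O => G.genCutAct (subgraph R σu σb O))
      (fun O => G.genCycleAct (subgraph R σu σb O)) (subgraph R σu σb)
      k₁ k₂ l m x w x' w' y z y' z' =
    ∑ S : Finset G.edgeSet,
      (k₁ * x + m * x') ^ (G.genCutAct S ∩ S).card * (k₂ * w + l * w') ^ (G.genCutAct S \ S).card *
      (k₂ * y + l * y') ^ (G.genCycleAct S \ S).card *
      (k₁ * z + m * z') ^ (G.genCycleAct S ∩ S).card *
      (k₁ + m) ^ (S \ (G.genCutAct S ∪ G.genCycleAct S)).card *
      (k₂ + l) ^ (Sᶜ \ (G.genCutAct S ∪ G.genCycleAct S)).card := by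
  simp only [← sum_activity_monomials (disjoint_genCutAct_genCycleAct R _)]
  rw [← Fintype.sum_prod_type', ← (bijective_subgraph_ori R σu σb).sum_comp, fourientationSum]
  refine Finset.sum_congr rfl fun O _ => ?_
  have hu : ∀ e, e ∈ O.unor → e ∉ subgraph R σu σb O := fun e => notMem_subgraph_of_mem_unor
  have hb : ∀ e, e ∈ O.bior → e ∈ subgraph R σu σb O := fun e => mem_subgraph_of_mem_bior
  have hact : ∀ e ∈ O.ori, _ := fun e he =>
    mem_subgraph_of_active (R := R) (σu := σu) (σb := σb) he
  dsimp only
  generalize subgraph R σu σb O = S at hu hb hact ⊢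
  obtain ⟨h1, h2⟩ := unor_bior_eq hu hb
  obtain ⟨h3, h4⟩ := inter_pos_neg_eq fun e hI he => (hact e he).1 hI
  obtain ⟨h5, h6⟩ := inter_pos_neg_eq' fun e hL he => (hact e he).2 hL
  rw [h1, h2, h3, h4, h5, h6]

lemma pow_mul_div_pow_eq {K : Type*} [Field K] {a b : K} (ha : a ≠ 0) (hb : b ≠ 0) (p q u v : K)
    (i j r h k t : ℕ) :
    a ^ (i + j + r) * b ^ (h + k + t) * ((p / a) ^ i * (q / a) ^ j * (u / b) ^ k * (v / b) ^ h) =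
      p ^ i * q ^ j * u ^ k * v ^ h * a ^ r * b ^ t := by
  simp only [div_pow, pow_add]
  field_simp

open Fourientation in
theorem tutte_eq_fourientationSum (R : G.RefOrientation) (σu σb : G.edgeSet → Bool)
    {K : Type*} [Field K] (k₁ k₂ l m x w x' w' y z y' z' : K) (ha : k₁ + m ≠ 0)
    (hb : k₂ + l ≠ 0) :
    (k₁ + m) ^ G.rk * (k₂ + l) ^ G.cyclomatic *
        G.tutte ((k₁ * x + k₂ * w + m * x' + l * w') / (k₁ + m))
          ((k₂ * y + k₁ * z + l * y' + m * z') / (k₂ + l)) =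
      fourientationSum (fun O => G.genCutAct (subgraph R σu σb O))
        (fun O => G.genCycleAct (subgraph R σu σb O)) (subgraph R σu σb)
        k₁ k₂ l m x w x' w' y z y' z' := by
  have e1 : (k₁ * x + k₂ * w + m * x' + l * w') / (k₁ + m) =
      (k₁ * x + m * x') / (k₁ + m) + (k₂ * w + l * w') / (k₁ + m) := by
    rw [← add_div]
    congr 1
    ring
  have e2 : (k₂ * y + k₁ * z + l * y' + m * z') / (k₂ + l) =
      (k₂ * y + l * y') / (k₂ + l) + (k₁ * z + m * z') / (k₂ + l) := by
    rw [← add_div]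
    congr 1
    ring
  rw [e1, e2, tutte_eq_gordonTraldiSum R, gordonTraldiSum, fourientationSum_eq_sum_subgraph,
    Finset.mul_sum]
  refine Finset.sum_congr rfl fun S _ => ?_
  have hdisj := disjoint_genCutAct_genCycleAct R S
  have c1 := numComponents_eq_add_card R S
  have c2 := card_add_numComponents R S
  -- With the two component counts, this shows that the rank is the number of cut active edges plus
  -- the inactive edges in `S`; the cyclomatic number is the number of cycle active edges plus the
  -- inactive edges outside `S`. The powers of `k₁ + m` and `k₂ + l` thus clear the denominators and
  -- leave the weights of the inactive edges.
  have hS : ∀ T : Finset G.edgeSet, T.card = (G.genCutAct S ∩ T).card +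
      (G.genCycleAct S ∩ T).card + (T \ (G.genCutAct S ∪ G.genCycleAct S)).card := by
    intro T
    rw [← Finset.card_union_of_disjoint, ← Finset.union_inter_distrib_right, Finset.inter_comm,
      Finset.card_inter_add_card_sdiff]
    exact hdisj.mono Finset.inter_subset_left Finset.inter_subset_left
  have c3 := hS S
  have c4 := hS Sᶜ
  have c5 := Finset.card_add_card_compl S
  rw [← Finset.sdiff_eq_inter_compl, ← Finset.sdiff_eq_inter_compl] at c4
  have hr : G.rk = (G.genCutAct S ∩ S).card + (G.genCutAct S \ S).card +
      (S \ (G.genCutAct S ∪ G.genCycleAct S)).card := by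
    rw [rk]
    omega
  have hg : G.cyclomatic = (G.genCycleAct S ∩ S).card + (G.genCycleAct S \ S).card +
      (Sᶜ \ (G.genCutAct S ∪ G.genCycleAct S)).card := by
    rw [cyclomatic]
    omega
  rw [hr, hg]
  exact pow_mul_div_pow_eq ha hb ..

end Graph

/-! ### The main theorem -/

open Graph.Fourientation in
theorem theorem1 {α : Type*} {β : Type*} (G : Graph α β) [Fintype G.vertexSet] [Fintype G.edgeSet]
    [LinearOrder G.edgeSet] (R : G.RefOrientation) (σu σb : G.edgeSet → Bool) :
    ∃ I L φ : G.Fourientation → Finset G.edgeSet,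
      -- `φ` is a `2 ^ |E|`-to-one surjection with the following properties
      (∀ S : Finset G.edgeSet,
        Nat.card {O : G.Fourientation // φ O = S} = 2 ^ Fintype.card G.edgeSet) ∧
      Function.Bijective (fun O : G.Fourientation => (φ O, O.ori)) ∧
      (∀ O : G.Fourientation, O.unor ∩ φ O = ∅ ∧ O.bior ⊆ φ O) ∧
      -- the activities are the generalized activities of `φ O` ...
      (∀ O : G.Fourientation, I O = G.genCutAct (φ O) ∧ L O = G.genCycleAct (φ O)) ∧
      -- ... and have the prescribed oriented, unoriented and bioriented parts
      (∀ O : G.Fourientation,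
        I O ∩ O.ori = O.cutActOri R ∧ I O ∩ O.unor = O.cutActUnor R σu ∧
        L O ∩ O.ori = O.cycleActOri R ∧ L O ∩ O.bior = O.cycleActBior R σb) ∧
      (∀ O : G.Fourientation,
        I O ∩ O.pos ⊆ φ O ∧ (I O ∩ O.neg) ∩ φ O = ∅ ∧
        L O ∩ O.neg ⊆ φ O ∧ (L O ∩ O.pos) ∩ φ O = ∅) ∧
      (∀ O : G.Fourientation, O.ori = ∅ →
        I O = G.genCutAct O.bior ∧ L O = G.genCycleAct O.bior) ∧
      ∀ (K : Type*) [Field K] (x w x' w' y z y' z' : K),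
        -- the twelve variable expansion
        (∀ k₁ k₂ l m : K, k₁ + m ≠ 0 → k₂ + l ≠ 0 →
          (k₁ + m) ^ G.rk * (k₂ + l) ^ G.cyclomatic *
              G.tutte ((k₁ * x + k₂ * w + m * x' + l * w') / (k₁ + m))
                ((k₂ * y + k₁ * z + l * y' + m * z') / (k₂ + l)) =
            Graph.fourientationSum I L φ k₁ k₂ l m x w x' w' y z y' z') ∧
        -- its specialization at `(k₁, k₂, l, m) = (0, 0, 1, 1)`
        (G.tutte (x' + w') (y' + z') =
            Graph.fourientationSum I L φ 0 0 1 1 x w x' w' y z y' z' ∧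
          Graph.fourientationSum I L φ 0 0 1 1 x w x' w' y z y' z' =
            G.gordonTraldiSum x' w' y' z') ∧
        -- its specialization at `(k₁, k₂, l, m) = (1, 1, 0, 0)`
        (G.tutte (x + w) (y + z) =
            Graph.fourientationSum I L φ 1 1 0 0 x w x' w' y z y' z' ∧
          Graph.fourientationSum I L φ 1 1 0 0 x w x' w' y z y' z' =
            Graph.lasVergnasSum R x w y z) := by
  refine ⟨fun O => G.genCutAct (subgraph R σu σb O), fun O => G.genCycleAct (subgraph R σu σb O),
    subgraph R σu σb, card_subgraph_eq R σu σb, bijective_subgraph_ori R σu σb, fun O => ⟨?_, ?_⟩,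
    fun O => ⟨rfl, rfl⟩, fun O => ⟨genCutAct_inter_ori O, genCutAct_inter_unor O,
      genCycleAct_inter_ori O, genCycleAct_inter_bior O⟩, fun O => ?_, fun O hO => ?_, ?_⟩
  · rw [Finset.eq_empty_iff_forall_notMem]
    intro e he
    rw [Finset.mem_inter] at he
    exact notMem_subgraph_of_mem_unor he.1 he.2
  · exact fun e he => mem_subgraph_of_mem_bior he
  · have hact : ∀ e, _ := fun e =>
      mem_subgraph_of_active (R := R) (σu := σu) (σb := σb) (O := O) (f := e)
    simp only [mem_ori] at hact
    simp only [Finset.eq_empty_iff_forall_notMem, Finset.subset_iff, Finset.mem_inter, mem_pos,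
      mem_neg]
    refine ⟨fun e => ?_, fun e => ?_, fun e => ?_, fun e => ?_⟩
    all_goals
      have := hact e
      tauto
  · have h : subgraph R σu σb O = O.bior := by rw [subgraph, resolve_of_ori_eq_empty hO]
    exact ⟨congrArg _ h, congrArg _ h⟩
  · intro K _ x w x' w' y z y' z'
    have key := fun k₁ k₂ l m : K =>
      Graph.tutte_eq_fourientationSum R σu σb k₁ k₂ l m x w x' w' y z y' z'
    have hgt := key 0 0 1 1 (by simp) (by simp)
    have hlv := key 1 1 0 0 (by simp) (by simp)
    simp only [zero_mul, one_mul, zero_add, add_zero, one_pow, div_one] at hgt hlv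
    refine ⟨key, ⟨hgt, ?_⟩, hlv, ?_⟩
    · rw [← hgt, Graph.tutte_eq_gordonTraldiSum R]
    · exact Graph.fourientationSum_eq_lasVergnasSum genCutAct_inter_ori genCycleAct_inter_ori ..
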